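/- **Setting.** There are $K\ge 1$ queries with unknown scores $s=(s_k)\in\mathbb R^K$ and $J\ge 1$ judges with known costs $c_j>0$. Each call of judge $j$ on query $k$ costs $c_j$ and returns an independent sample of $\mathcal N(s_k,\sigma_{k,j}^2)$, where the $\sigma_{k,j}>0$ are unknown. For $p\in[1,\infty]$ let $$\mathcal A_p^*=\min_{\omega}\Big(\sum_{k}\Big(\sum_{j}\frac{\omega_{k,j}}{c_j\sigma_{k,j}^2}\Big)^{-p/2}\Big)^{2/p},$$ where $\omega$ ranges over the probability vectors indexed by the pairs $(k,j)$ (for $p=\infty$ the objective is $\max_k(\sum_j\omega_{k,j}/(c_j\sigma_{k,j}^2))^{-1}$). An algorithm that outputs $\hat s$ after $N_{k,j}$ calls of judge $j$ on query $k$ is *$(B,\delta,\ell_p)$-budget efficient* at $(s,\sigma,c)$ with error rate $\varepsilon>0$ if $\mathbb P(\|\hat s-s\|_p\le\varepsilon)\ge 1-\delta$ and $\sum_{j}c_j\sum_k N_{k,j}\le B$ almost surely. **Algorithm (Gaussian Est-IVWE, with input $p$, $B$, $c$, $N_0$).** *Phase I:* call every pair $(k,j)$ exactly $N_0$ times and compute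 the unbiased sample variance $\hat\sigma_{k,j}^2$ (no bias term is added). *Phase II:* let $B'=B-N_0K\sum_jc_j$, $\hat\jmath(k)=\arg\min_j c_j\hat\sigma_{k,j}^2$ (smallest index in case of ties), and $$\hat\omega_k=\frac{(c_{\hat\jmath(k)}\hat\sigma_{k,\hat\jmath(k)}^2)^{p/(p+2)}}{\sum_{k'}(c_{\hat\jmath(k')}\hat\sigma_{k',\hat\jmath(k')}^2)^{p/(p+2)}},$$ with exponent $1$ for $p=\infty$. Numbers of calls are integers, so the cost of one call per query is set aside and the allocation is rounded up: judge $\hat\jmath(k)$ is called $\hat N_k=\big\lceil (B'-\sum_{k'}c_{\hat\jmath(k')})_+\,\hat\omega_k/c_{\hat\jmath(k)}\big\rceil$ further times on query $k$, the other judges not at all. Return the inverse-variance weighted estimator of the new samples with $\hat\sigma_{k,j}^2$ as variance proxies, i.e. $\hat s_k$ is the mean of the $\hat N_k$ new samples ($\hat s_k=0$ if $\hat N_k=0$). **Theorem.** There is an absolute constant $M_0>0$ such that the following holds for all $K,J\ge1$, $p\in[1,\infty]$, $\delta\in(0,1)$ and all instances $(s,\sigma,c)$. Put $N_0=1+\lceil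 16\log\frac{4KJ}{\delta}\rceil$. 1. For every $B\ge 2N_0K\sum_jc_j$, Gaussian Est-IVWE is $(B,\delta,\ell_p)$-budget efficient at $(s,\sigma,c)$ with error rate $$\varepsilon_p=\sqrt{\frac{13\,\mathcal A_p^*\log\frac{4K}{\delta}}{2B}}+M_0\Big(K\sum_jc_j\Big)\frac{\sqrt{\mathcal A_p^*}\,\big(\log\frac{KJ}{\delta}\big)^{3/2}}{B^{3/2}}.$$ 2. There is a constant $M>0$, which may depend on $K,J,p,\delta$ and $(s,\sigma,c)$ but not on $B$, such that for every $B\ge N_0K\sum_jc_j$ Gaussian Est-IVWE is $(B,\delta,\ell_p)$-budget efficient at $(s,\sigma,c)$ with error rate $$\varepsilon_p=\sqrt{\frac{13\,\mathcal A_p^*\log\frac{4K}{\delta}}{2B}}+M\,\frac{\sqrt{\mathcal A_p^*}\,\big(\log\frac{KJ}{\delta}\big)^{3/2}}{B^{3/2}}.$$ -/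

import Mathlib

open MeasureTheory ProbabilityTheory
open scoped ENNReal NNReal

noncomputable section

namespace BudgetedJudges

/-- A table of scores: the entry `x (k, j, n)` is the score returned by the `n`-th call (counted
from `0`) of judge `j` on query `k`. -/
abbrev ScoreTable (K J : ℕ) : Type := Fin K × Fin J × ℕ → ℝ

/-- The law of the scores in the Gaussian model: all scores are independent, and every score of
query `k` by judge `j` is distributed as `𝒩(s k, (σ k j)²)`. -/
def gaussianScores {K J : ℕ} (s : Fin K → ℝ) (σ : Fin K → Fin J → ℝ) :
    Measure (ScoreTable K J) :=
  Measure.infinitePi fun i : Fin K × Fin J × ℕ => gaussianReal (s i.1) ((σ i.1 i.2.1 ^ 2).toNNReal)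

/-- An estimation algorithm for `K` queries and `J` judges: from the scores it produces the number
of calls made to every query-judge pair and an estimate of the score vector. The condition
`adapted` says that both are determined by the scores that were actually observed. -/
structure Algorithm (K J : ℕ) where
  /-- the number `N k j` of calls of judge `j` on query `k` -/
  counts : ScoreTable K J → Fin K → Fin J → ℕ
  /-- the estimate of the score vector -/
  estimate : ScoreTable K J → Fin K → ℝ
  measurable_counts : Measurable counts
  measurable_estimate : Measurable estimate
  adapted : ∀ x y : ScoreTable K J,
    (∀ k j n, n < counts x k j → x (k, j, n) = y (k, j, n)) →
      counts y = counts x ∧ estimate y = estimate x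

/-- `(B, δ, ℓ_p)`-budget efficiency at the instance `(s, σ, c)` with error rate `ε`, for Gaussian
scores. -/
structure IsBudgetEfficient {K J : ℕ} (alg : Algorithm K J) (B δ : ℝ) (p : ℝ≥0∞)
    (s : Fin K → ℝ) (σ : Fin K → Fin J → ℝ) (c : Fin J → ℝ) (ε : ℝ) : Prop where
  rate_pos : 0 < ε
  accurate : ENNReal.ofReal (1 - δ) ≤ gaussianScores s σ
    {x | ‖(WithLp.toLp p (alg.estimate x - s) : PiLp p fun _ : Fin K => ℝ)‖ ≤ ε}
  within_budget : ∀ᵐ x ∂(gaussianScores s σ),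
    ∑ j, c j * ∑ k, (alg.counts x k j : ℝ) ≤ B

/-- The allocation objective
`𝒜_p(ω; σ, c) = (∑_k (∑_j ω_{k,j} / (c_j σ_{k,j}²))^(-p/2))^(2/p)`, with its usual reading
`max_k (∑_j ω_{k,j} / (c_j σ_{k,j}²))⁻¹` at `p = ∞`. It takes the value `∞` if some query
receives no budget. -/
def allocationObjective {K J : ℕ} (p : ℝ≥0∞) (σ : Fin K → Fin J → ℝ) (c : Fin J → ℝ)
    (ω : Fin K × Fin J → ℝ) : ℝ≥0∞ :=
  if p = ∞ then ⨆ k, (∑ j, ENNReal.ofReal (ω (k, j) / (c j * σ k j ^ 2)))⁻¹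
  else (∑ k, (∑ j, ENNReal.ofReal (ω (k, j) / (c j * σ k j ^ 2))) ^ (-(p.toReal / 2)))
    ^ (2 / p.toReal)

/-- The optimal value `𝒜_p^*(σ, c)` of the allocation objective over the probability simplex. -/
def optimalObjective {K J : ℕ} (p : ℝ≥0∞) (σ : Fin K → Fin J → ℝ) (c : Fin J → ℝ) : ℝ :=
  (⨅ ω ∈ stdSimplex ℝ (Fin K × Fin J), allocationObjective p σ c ω).toReal

/-- The exponent `p / (p + 2)`, read as `1` at `p = ∞`. -/
def allocationExponent (p : ℝ≥0∞) : ℝ := if p = ∞ then 1 else p.toReal / (p.toReal + 2)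

section Selection

variable {J : ℕ}

/-- The set of minimisers of a real function on the judges. -/
def minimisers (g : Fin J → ℝ) : Finset (Fin J) :=
  haveI := Classical.decPred fun j => ∀ j', g j ≤ g j'
  Finset.univ.filter fun j => ∀ j', g j ≤ g j'

theorem mem_minimisers (g : Fin J → ℝ) (j : Fin J) : j ∈ minimisers g ↔ ∀ j', g j ≤ g j' := by
  simp [minimisers]

variable [NeZero J]

theorem minimisers_nonempty (g : Fin J → ℝ) : (minimisers g).Nonempty := by
  obtain ⟨j, -, hj⟩ := Finset.exists_min_image Finset.univ g ⟨0, Finset.mem_univ _⟩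
  exact ⟨j, (mem_minimisers g j).2 fun j' => hj j' (Finset.mem_univ _)⟩

/-- `argmin_j g j`; ties are broken in favour of the smallest index. -/
def argminJudge (g : Fin J → ℝ) : Fin J := (minimisers g).min' (minimisers_nonempty g)

theorem argminJudge_le (g : Fin J → ℝ) (j : Fin J) : g (argminJudge g) ≤ g j :=
  (mem_minimisers g _).1 (Finset.min'_mem _ _) j

theorem argminJudge_eq_iff (g : Fin J → ℝ) (j : Fin J) :
    argminJudge g = j ↔ (∀ j', g j ≤ g j') ∧ ∀ i, (∀ j', g i ≤ g j') → j ≤ i := by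
  constructor
  · rintro rfl
    exact ⟨argminJudge_le g, fun i hi => Finset.min'_le _ _ ((mem_minimisers g i).2 hi)⟩
  · rintro ⟨h1, h2⟩
    exact le_antisymm (Finset.min'_le _ _ ((mem_minimisers g j).2 h1)) (h2 _ (argminJudge_le g))

theorem measurable_argminJudge : Measurable (argminJudge : (Fin J → ℝ) → Fin J) := by
  refine measurable_to_countable' fun j => ?_
  have h : (argminJudge : (Fin J → ℝ) → Fin J) ⁻¹' {j} =
      {g | (∀ j', g j ≤ g j') ∧ ∀ i, (∀ j', g i ≤ g j') → j ≤ i} := by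
    ext g
    exact argminJudge_eq_iff g j
  rw [h]
  have hm : ∀ i : Fin J, MeasurableSet {g : Fin J → ℝ | ∀ j', g i ≤ g j'} := fun i => by
    rw [Set.ofPred_forall]
    exact MeasurableSet.iInter fun j' =>
      measurableSet_le (measurable_pi_apply i) (measurable_pi_apply j')
  have h2 : MeasurableSet {g : Fin J → ℝ | ∀ i, (∀ j', g i ≤ g j') → j ≤ i} := by
    rw [Set.ofPred_forall]
    exact MeasurableSet.iInter fun i => (hm i).imp (MeasurableSet.const _)
  exact (hm j).inter h2

end Selection

section Estimators

variable {K J : ℕ}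

/-- The mean of the `N` scores of judge `j` on query `k` that come after the first `a` ones
(`0` if `N = 0`). -/
def sampleMean (x : ScoreTable K J) (a N : ℕ) (k : Fin K) (j : Fin J) : ℝ :=
  (N : ℝ)⁻¹ * ∑ i ∈ Finset.range N, x (k, j, a + i)

/-- The (unbiased) sample variance of the first `N₀` scores of judge `j` on query `k`. -/
def sampleVariance (N₀ : ℕ) (x : ScoreTable K J) (k : Fin K) (j : Fin J) : ℝ :=
  ((N₀ : ℝ) - 1)⁻¹ * ∑ n ∈ Finset.range N₀, (x (k, j, n) - sampleMean x 0 N₀ k j) ^ 2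

/-- The inverse-variance weighted estimator with allocation `N` and variance proxies `v`, computed
from the scores that come after the first `a` ones of every query-judge pair. -/
def ivwe (N : Fin K → Fin J → ℕ) (v : Fin K → Fin J → ℝ) (a : ℕ) (x : ScoreTable K J)
    (k : Fin K) : ℝ :=
  (∑ j, (N k j : ℝ) / v k j)⁻¹ * ∑ j, (N k j : ℝ) * sampleMean x a (N k j) k j / v k j

theorem measurable_sampleVariance (N₀ : ℕ) :
    Measurable (sampleVariance N₀ : ScoreTable K J → Fin K → Fin J → ℝ) := by
  refine measurable_pi_lambda _ fun k => measurable_pi_lambda _ fun j => ?_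
  unfold sampleVariance sampleMean
  fun_prop

theorem measurable_sampleMean {N : ScoreTable K J → ℕ} (hN : Measurable N) (a : ℕ)
    (k : Fin K) (j : Fin J) : Measurable fun x => sampleMean x a (N x) k j := by
  have h : Measurable (Function.uncurry fun (n : ℕ) (x : ScoreTable K J) =>
      sampleMean x a n k j) := by
    refine measurable_from_prod_countable_right fun n => ?_
    simp only [Function.uncurry, sampleMean]
    fun_prop
  exact h.comp (hN.prodMk measurable_id)

theorem measurable_ivwe {N : ScoreTable K J → Fin K → Fin J → ℕ}
    {v : ScoreTable K J → Fin K → Fin J → ℝ} (hN : Measurable N) (hv : Measurable v) (a : ℕ) :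
    Measurable fun x => ivwe (N x) (v x) a x := by
  have hN' : ∀ k j, Measurable fun x => N x k j := fun k j =>
    (measurable_pi_apply j).comp ((measurable_pi_apply k).comp hN)
  have hv' : ∀ k j, Measurable fun x => v x k j := fun k j =>
    (measurable_pi_apply j).comp ((measurable_pi_apply k).comp hv)
  have hc : ∀ k j, Measurable fun x => (N x k j : ℝ) := fun k j =>
    (measurable_of_countable (Nat.cast : ℕ → ℝ)).comp (hN' k j)
  refine measurable_pi_lambda _ fun k => ?_
  exact (Finset.measurable_sum _ fun j _ => (hc k j).div (hv' k j)).inv.mul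
    (Finset.measurable_sum _ fun j _ =>
      ((hc k j).mul (measurable_sampleMean (hN' k j) a k j)).div (hv' k j))

theorem sampleVariance_congr {N₀ : ℕ} {x y : ScoreTable K J}
    (h : ∀ k j n, n < N₀ → x (k, j, n) = y (k, j, n)) :
    sampleVariance N₀ y = sampleVariance N₀ x := by
  have hm : ∀ k j, sampleMean y 0 N₀ k j = sampleMean x 0 N₀ k j := fun k j => by
    unfold sampleMean
    congr 1
    refine Finset.sum_congr rfl fun i hi => ?_
    rw [h k j (0 + i) (by simpa using hi)]
  funext k j
  unfold sampleVariance
  congr 1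
  refine Finset.sum_congr rfl fun i hi => ?_
  rw [hm, h k j i (Finset.mem_range.1 hi)]

end Estimators

section EstIVWE

variable {K J : ℕ} [NeZero J]

/-- The judge that is optimal for query `k` if the variances are `v`. -/
def optimalJudge (c : Fin J → ℝ) (v : Fin K → Fin J → ℝ) (k : Fin K) : Fin J :=
  argminJudge fun j => c j * v k j

/-- `(c_{j*(k)} v_{k,j*(k)})^(p/(p+2))`, where `j*(k)` is the optimal judge of query `k`. -/
def queryWeight (p : ℝ≥0∞) (c : Fin J → ℝ) (v : Fin K → Fin J → ℝ) (k : Fin K) : ℝ :=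
  (c (optimalJudge c v k) * v k (optimalJudge c v k)) ^ allocationExponent p

/-- The optimal share of the budget for the pair `(k, j)` if the variances are `v`. -/
def optimalShare (p : ℝ≥0∞) (c : Fin J → ℝ) (v : Fin K → Fin J → ℝ) (k : Fin K) (j : Fin J) : ℝ :=
  if j = optimalJudge c v k then queryWeight p c v k / ∑ k', queryWeight p c v k' else 0

/-- The integer version of the optimal allocation of the budget `B'` if the variances are `v`. The
cost of one call per query is set aside, and the real numbers of calls that the rest of the budget
pays for are rounded up. -/
def optimalCounts (p : ℝ≥0∞) (c : Fin J → ℝ) (B' : ℝ) (v : Fin K → Fin J → ℝ)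
    (k : Fin K) (j : Fin J) : ℕ :=
  ⌈(B' - ∑ k', c (optimalJudge c v k')) * optimalShare p c v k j / c j⌉₊

/-- The allocation of the second phase: the budget left by the first phase, which calls every
query-judge pair `N₀` times, is allocated with the sample variances in place of the variances. -/
def phaseTwoCounts (p : ℝ≥0∞) (c : Fin J → ℝ) (B : ℝ) (N₀ : ℕ) (x : ScoreTable K J) :
    Fin K → Fin J → ℕ :=
  optimalCounts p c (B - N₀ * (K * ∑ j, c j)) (sampleVariance N₀ x)

theorem measurable_optimalJudge (c : Fin J → ℝ) (k : Fin K) :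
    Measurable fun v : Fin K → Fin J → ℝ => optimalJudge c v k :=
  measurable_argminJudge.comp (by fun_prop)

theorem measurable_queryWeight (p : ℝ≥0∞) (c : Fin J → ℝ) (k : Fin K) :
    Measurable fun v : Fin K → Fin J → ℝ => queryWeight p c v k := by
  have h : Measurable fun q : Fin J × (Fin K → Fin J → ℝ) => c q.1 * q.2 k q.1 :=
    measurable_from_prod_countable_right fun j => by
      simp only
      fun_prop
  exact (h.comp ((measurable_optimalJudge c k).prodMk measurable_id)).pow_const _

theorem measurable_optimalCounts (p : ℝ≥0∞) (c : Fin J → ℝ) (B' : ℝ) :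
    Measurable (optimalCounts p c B' : (Fin K → Fin J → ℝ) → Fin K → Fin J → ℕ) := by
  refine measurable_pi_lambda _ fun k => measurable_pi_lambda _ fun j => ?_
  have h1 : ∀ k' : Fin K, Measurable fun v : Fin K → Fin J → ℝ => c (optimalJudge c v k') :=
    fun k' => (measurable_of_countable c).comp (measurable_optimalJudge c k')
  have h2 : Measurable fun v : Fin K → Fin J → ℝ => optimalShare p c v k j := by
    unfold optimalShare
    refine Measurable.ite ?_ ?_ measurable_const
    · exact measurableSet_eq_fun measurable_const (measurable_optimalJudge c k)
    · exact (measurable_queryWeight p c k).div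
        (Finset.measurable_sum _ fun k' _ => measurable_queryWeight p c k')
  exact Nat.measurable_ceil.comp (((measurable_const.sub
    (Finset.measurable_sum _ fun k' _ => h1 k')).mul h2).div_const _)

theorem measurable_phaseTwoCounts (p : ℝ≥0∞) (c : Fin J → ℝ) (B : ℝ) (N₀ : ℕ) :
    Measurable (phaseTwoCounts p c B N₀ : ScoreTable K J → Fin K → Fin J → ℕ) :=
  (measurable_optimalCounts p c _).comp (measurable_sampleVariance N₀)

/-- The Gaussian estimate-then-IVWE algorithm. First phase: every query-judge pair is called `N₀`
times and its sample variance is computed. Second phase: the remaining budget is allocated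
optimally for these sample variances, and the inverse-variance weighted estimator, with the sample
variances as variance proxies, is computed from the new scores. -/
def estIVWEGaussian (p : ℝ≥0∞) (c : Fin J → ℝ) (B : ℝ) (N₀ : ℕ) : Algorithm K J where
  counts x k j := N₀ + phaseTwoCounts p c B N₀ x k j
  estimate x := ivwe (phaseTwoCounts p c B N₀ x) (sampleVariance N₀ x) N₀ x
  measurable_counts := by
    have h := measurable_phaseTwoCounts (K := K) p c B N₀
    refine measurable_pi_lambda _ fun k => measurable_pi_lambda _ fun j => ?_
    exact measurable_const.add ((measurable_pi_apply j).comp ((measurable_pi_apply k).comp h))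
  measurable_estimate :=
    measurable_ivwe (measurable_phaseTwoCounts p c B N₀) (measurable_sampleVariance N₀) N₀
  adapted x y h := by
    have hv : sampleVariance N₀ y = sampleVariance N₀ x :=
      sampleVariance_congr fun k j n hn => h k j n (by omega)
    have hN : phaseTwoCounts p c B N₀ y = phaseTwoCounts p c B N₀ x := by
      unfold phaseTwoCounts
      rw [hv]
    have hs : ∀ k j, sampleMean y N₀ (phaseTwoCounts p c B N₀ x k j) k j =
        sampleMean x N₀ (phaseTwoCounts p c B N₀ x k j) k j := fun k j => by
      unfold sampleMean
      congr 1
      refine Finset.sum_congr rfl fun i hi => ?_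
      rw [h k j (N₀ + i) (by have := Finset.mem_range.1 hi; omega)]
    refine ⟨by rw [hN], ?_⟩
    rw [hN, hv]
    funext k
    unfold ivwe
    simp only [hs]

end EstIVWE

end BudgetedJudges

end

/-! Suppose judge `j` answers query `k` with share `w` of a budget `b`. This buys about `b * w / c
j` calls, so with `L = log (4K/δ)` the squared error is at most `2 * L / b * (c j * σ k j ^ 2 / w)`,
up to failure probability `2 * exp (-L)`. If `m k` is the cost-weighted variance of the chosen
judge, shares proportional to `m k ^ (p/(p+2))` turn these bounds into the `ℓ_p` bound `√(2 * L / b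
* closedForm p m)`. Conversely, Hölder's inequality shows that no allocation has an objective below
`closedForm` of the minimal cost-weighted variances (`ofReal_closedForm_le_allocationObjective`).
Only this direction of the duality is needed.

The algorithm uses sample variances instead. Such a variance is `σ²/(N₀-1)` times a chi-square
variable with `N₀-1` degrees of freedom, so the choice of `N₀` puts all of them in `[σ²/2, 13/8 σ²]`
at once with high probability. The lower end costs a factor 2 when the true variance of the chosen
judge is replaced by its estimate; the upper end costs `13/8` when `closedForm` of the estimates is
compared with that of the true variances. Together `2 * 2 * 13/8 = 13/2`, the leading constant.

The chosen judge and the number of new calls are random, but they depend on the first phase only and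
are thus independent of the new scores; conditioning on them preserves the Gaussian tail bound
(`measure_sampleMean_random_sub_gt_le`).

The first phase and the set-aside for rounding reduce the budget by at most `(N₀ + 1) * K * ∑ j, c
j`. Expanding the square root around `B` turns this loss into the term of order `B^(-3/2)`. -/

/-! ### Chi-square law and tails of the centred sum of squares -/

/-- The centred sum of squares `∑ i, (z i - z̄)²`. -/
noncomputable def centredSumSq {n : ℕ} (z : Fin (n + 1) → ℝ) : ℝ :=
  ∑ i, (z i - ((n + 1 : ℕ) : ℝ)⁻¹ * ∑ j, z j) ^ 2

theorem centredSumSq_eq {n : ℕ} (z : Fin (n + 1) → ℝ) :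
    centredSumSq z = ∑ i, z i ^ 2 - ((n + 1 : ℕ) : ℝ)⁻¹ * (∑ j, z j) ^ 2 := by
  have h : ((n + 1 : ℕ) : ℝ) ≠ 0 := by positivity
  unfold centredSumSq
  simp only [sub_sq, Finset.sum_add_distrib, Finset.sum_sub_distrib, ← Finset.mul_sum,
    ← Finset.sum_mul, Finset.sum_const, Finset.card_univ, Fintype.card_fin, nsmul_eq_mul]
  field_simp
  ring

theorem measurable_centredSumSq {n : ℕ} : Measurable (centredSumSq (n := n)) := by
  unfold centredSumSq
  fun_prop

/-- The moment generating function of the square of a standard Gaussian. -/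
theorem hasMgf_sq_gaussianReal {t : ℝ} (ht : t < 1 / 2) :
    Integrable (fun x : ℝ => Real.exp (t * x ^ 2)) (gaussianReal 0 1) ∧
      mgf (fun x : ℝ => x ^ 2) (gaussianReal 0 1) t = (√(1 - 2 * t))⁻¹ := by
  have hb : 0 < 1 / 2 - t := by linarith
  have key : ∀ x : ℝ, gaussianPDFReal 0 1 x * Real.exp (t * x ^ 2) =
      (√(2 * Real.pi))⁻¹ * Real.exp (-(1 / 2 - t) * x ^ 2) := fun x => by
    rw [gaussianPDFReal_def]
    simp only [NNReal.coe_one, mul_one, sub_zero, mul_assoc, ← Real.exp_add]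
    ring_nf
  constructor
  · rw [gaussianReal_of_var_ne_zero _ one_ne_zero, gaussianPDF_def,
      integrable_withDensity_iff_integrable_smul₀' (by fun_prop) (by simp)]
    simp only [ENNReal.toReal_ofReal (gaussianPDFReal_nonneg _ _ _), smul_eq_mul, key]
    exact (integrable_exp_neg_mul_sq hb).const_mul _
  · rw [mgf, integral_gaussianReal_eq_integral_smul one_ne_zero]
    simp only [smul_eq_mul, key]
    rw [integral_const_mul, integral_gaussian, ← Real.sqrt_inv, ← Real.sqrt_mul (by positivity),
      ← Real.sqrt_inv]
    congr 1
    have : 1 - 2 * t ≠ 0 := by linarith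
    field_simp

/-- A rotation with the direction of the mean as first axis separates the sample mean from the
centred sum of squares. -/
theorem exists_orthonormalBasis_zero_eq_const (n : ℕ) :
    ∃ b : OrthonormalBasis (Fin (n + 1)) ℝ (EuclideanSpace ℝ (Fin (n + 1))),
      ∀ i, b 0 i = (√((n + 1 : ℕ) : ℝ))⁻¹ := by
  have h0 : (0 : ℝ) < ((n + 1 : ℕ) : ℝ) := by positivity
  set u : EuclideanSpace ℝ (Fin (n + 1)) := WithLp.toLp 2 fun _ => (√((n + 1 : ℕ) : ℝ))⁻¹
  have hu : ‖u‖ = 1 := by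
    rw [EuclideanSpace.norm_eq]
    simp only [u, norm_inv, Real.norm_eq_abs, abs_of_nonneg (Real.sqrt_nonneg _), inv_pow,
      Real.sq_sqrt h0.le, Finset.sum_const, Finset.card_univ, Fintype.card_fin, nsmul_eq_mul]
    rw [mul_inv_cancel₀ h0.ne', Real.sqrt_one]
  have hv : Orthonormal ℝ (({0} : Set (Fin (n + 1))).domRestrict fun _ => u) :=
    ⟨fun _ => hu, fun i j hij => (hij (Subsingleton.elim i j)).elim⟩
  obtain ⟨b, hb⟩ := hv.exists_orthonormalBasis_extension_of_card_eq (by simp)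
  exact ⟨b, fun i => by rw [hb 0 rfl]⟩

/-- By Parseval the sum of squares is `∑ i, x i ^ 2`, and the square subtracted by centring is
exactly `x 0 ^ 2`, the component along the mean direction. -/
theorem centredSumSq_orthonormalBasis {n : ℕ}
    {b : OrthonormalBasis (Fin (n + 1)) ℝ (EuclideanSpace ℝ (Fin (n + 1)))}
    (hb : ∀ i, b 0 i = (√((n + 1 : ℕ) : ℝ))⁻¹) (x : Fin (n + 1) → ℝ) :
    centredSumSq (WithLp.ofLp (∑ i, x i • b i)) = ∑ i : Fin n, x i.succ ^ 2 := by
  have h0 : (0 : ℝ) < ((n + 1 : ℕ) : ℝ) := by positivity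
  set y := ∑ i, x i • b i with hy
  have hr : ∀ i, inner ℝ (b i) y = x i := fun i => by
    rw [hy, inner_sum]
    simp [inner_smul_right, orthonormal_iff_ite.1 b.orthonormal]
  have hn : ∑ i, y i ^ 2 = ∑ i, x i ^ 2 := by
    have h1 := EuclideanSpace.norm_sq_eq y
    have h2 := b.sum_sq_norm_inner_right y
    simp only [Real.norm_eq_abs, sq_abs, hr] at h1 h2
    rw [← h1, h2]
  have h3 : ((n + 1 : ℕ) : ℝ)⁻¹ * (∑ j, y j) ^ 2 = x 0 ^ 2 := by
    rw [← hr 0, PiLp.inner_apply]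
    simp only [hb, RCLike.inner_apply, conj_trivial, ← Finset.sum_mul]
    rw [mul_pow, inv_pow, Real.sq_sqrt h0.le, mul_comm]
  rw [centredSumSq_eq, hn, h3, Fin.sum_univ_succ]
  ring

/-- The standard Gaussian law is invariant under rotation, so the centred sum of squares has the law
of a sum of `n` independent squares. One of the `n + 1` degrees of freedom is lost to the mean. -/
theorem hasMgf_centredSumSq (n : ℕ) {t : ℝ} (ht : t < 1 / 2) :
    Integrable (fun z => Real.exp (t * centredSumSq z))
        (Measure.pi fun _ : Fin (n + 1) => gaussianReal 0 1) ∧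
      mgf centredSumSq (Measure.pi fun _ : Fin (n + 1) => gaussianReal 0 1) t =
        (√(1 - 2 * t))⁻¹ ^ n := by
  obtain ⟨b, hb⟩ := exists_orthonormalBasis_zero_eq_const n
  set P := Measure.pi fun _ : Fin (n + 1) => gaussianReal 0 1 with hP
  have hmap : P.map (fun x => WithLp.ofLp (∑ i, x i • b i)) = P := by
    have h1 := stdGaussian_eq_map_pi_orthonormalBasis b
    have h2 := map_pi_eq_stdGaussian (ι := Fin (n + 1))
    have : (fun x : Fin (n + 1) → ℝ => WithLp.ofLp (∑ i, x i • b i)) =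
      WithLp.ofLp ∘ fun x => ∑ i, x i • b i := rfl
    rw [this, ← Measure.map_map (by fun_prop) (by fun_prop), hP, ← h1, ← h2,
      Measure.map_map (by fun_prop) (by fun_prop)]
    simp [Function.comp_def]
  have hmeas : Measurable fun x : Fin (n + 1) → ℝ => WithLp.ofLp (∑ i, x i • b i) := by fun_prop
  have hf : Measurable fun z : Fin (n + 1) → ℝ => Real.exp (t * centredSumSq z) := by
    have := measurable_centredSumSq (n := n)
    fun_prop
  set g : Fin (n + 1) → ℝ → ℝ := fun i y => if i = 0 then 1 else Real.exp (t * y ^ 2) with hg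
  have hcomp : ∀ x : Fin (n + 1) → ℝ,
      Real.exp (t * centredSumSq (WithLp.ofLp (∑ i, x i • b i))) = ∏ i, g i (x i) := fun x => by
    rw [centredSumSq_orthonormalBasis hb, Finset.mul_sum, Real.exp_sum, Fin.prod_univ_succ]
    simp [hg, Fin.succ_ne_zero]
  have hi := hasMgf_sq_gaussianReal ht
  constructor
  · rw [← hmap, integrable_map_measure hf.aestronglyMeasurable hmeas.aemeasurable]
    simp only [Function.comp_def, hcomp]
    refine Integrable.fintype_prod fun i => ?_
    by_cases h : i = 0
    · simp [hg, h]
    · simpa [hg, h] using hi.1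
  · rw [mgf, ← hmap, integral_map hmeas.aemeasurable hf.aestronglyMeasurable]
    simp only [hcomp]
    rw [integral_fintype_prod_eq_prod, Fin.prod_univ_succ, ← hi.2]
    simp [hg, Fin.succ_ne_zero, mgf]

/-- Chernoff's bound at `t = 5/26`, the optimal parameter for the threshold `13/8` because `1 - 2t =
8/13`. The claim reduces to `13/8 ≤ exp (1/2)`, and `13/8 = 1 + 1/2 + 1/8` is the quadratic Taylor
value. -/
theorem measure_centredSumSq_ge_le (n : ℕ) :
    (Measure.pi fun _ : Fin (n + 1) => gaussianReal 0 1).real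
      {z | 13 / 8 * (n : ℝ) ≤ centredSumSq z} ≤ Real.exp (-(n / 16)) := by
  obtain ⟨h1, h2⟩ := hasMgf_centredSumSq n (t := 5 / 26) (by norm_num)
  refine (measure_ge_le_exp_mul_mgf _ (by norm_num : (0 : ℝ) ≤ 5 / 26) h1).trans ?_
  rw [h2, show -(5 / 26 : ℝ) * (13 / 8 * n) = n * (-(5 / 16)) by ring,
    show -((n : ℝ) / 16) = n * (-(1 / 16)) by ring, Real.exp_nat_mul, Real.exp_nat_mul, ← mul_pow]
  refine pow_le_pow_left₀ (by positivity) ?_ _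
  have h3 : (13 / 8 : ℝ) ≤ Real.exp (1 / 2) := by
    have := Real.quadratic_le_exp_of_nonneg (x := 1 / 2) (by norm_num)
    linarith
  rw [show -(1 / 16 : ℝ) = -(5 / 16) + 1 / 4 by norm_num, Real.exp_add, ← Real.sqrt_inv]
  gcongr
  rw [Real.sqrt_le_left (by positivity), ← Real.exp_nat_mul]
  norm_num at h3 ⊢
  exact h3

/-- Chernoff's bound at the optimal parameter `t = -1/2`, where `1 - 2t = 2`. The claim reduces to
`exp (5/8) ≤ 2`. -/
theorem measure_centredSumSq_le_le (n : ℕ) :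
    (Measure.pi fun _ : Fin (n + 1) => gaussianReal 0 1).real
      {z | centredSumSq z ≤ (n : ℝ) / 2} ≤ Real.exp (-(n / 16)) := by
  obtain ⟨h1, h2⟩ := hasMgf_centredSumSq n (t := -(1 / 2)) (by norm_num)
  refine (measure_le_le_exp_mul_mgf _ (by norm_num : -(1 / 2) ≤ (0 : ℝ)) h1).trans ?_
  rw [h2, show -(-(1 / 2 : ℝ)) * (n / 2) = n * (1 / 4) by ring,
    show -((n : ℝ) / 16) = n * (-(1 / 16)) by ring, Real.exp_nat_mul, Real.exp_nat_mul, ← mul_pow]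
  refine pow_le_pow_left₀ (by positivity) ?_ _
  have h3 : Real.exp (5 / 8) ≤ 2 := by
    rw [← Real.le_log_iff_exp_le (by norm_num)]
    have := Real.log_two_gt_d9
    linarith
  rw [show -(1 / 16 : ℝ) = 1 / 4 + -(5 / 16) by norm_num, Real.exp_add, Real.exp_neg]
  gcongr
  refine Real.le_sqrt_of_sq_le ?_
  rw [← Real.exp_nat_mul]
  norm_num at h3 ⊢
  exact h3

/-! ### Concentration of the scores and probability of the good event -/

namespace BudgetedJudges

section Scores

variable {K J : ℕ} {s : Fin K → ℝ} {σ : Fin K → Fin J → ℝ}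

instance (s : Fin K → ℝ) (σ : Fin K → Fin J → ℝ) :
    IsProbabilityMeasure (gaussianScores s σ) := by
  unfold gaussianScores
  infer_instance

theorem iIndepFun_scores (s : Fin K → ℝ) (σ : Fin K → Fin J → ℝ) :
    iIndepFun (fun (i : Fin K × Fin J × ℕ) (x : ScoreTable K J) => x i) (gaussianScores s σ) :=
  iIndepFun_infinitePi (X := fun _ y => y) fun _ => measurable_id

theorem gaussianScores_map_eval (s : Fin K → ℝ) (σ : Fin K → Fin J → ℝ) (k : Fin K) (j : Fin J)
    (n : ℕ) : (gaussianScores s σ).map (fun x => x (k, j, n)) =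
      gaussianReal (s k) ((σ k j ^ 2).toNNReal) :=
  Measure.infinitePi_map_eval _ (k, j, n)

theorem gaussianScores_map_standardised {k : Fin K} {j : Fin J} (hσ : 0 < σ k j) (N : ℕ) :
    (gaussianScores s σ).map (fun x (i : Fin N) => (x (k, j, (i : ℕ)) - s k) / σ k j) =
      Measure.pi fun _ => gaussianReal 0 1 := by
  have hinj : Function.Injective fun i : Fin N => ((k, j, (i : ℕ)) : Fin K × Fin J × ℕ) :=
    fun a b h => by simpa [Fin.ext_iff] using h
  have h1 := ((iIndepFun_scores s σ).precomp hinj).comp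
    (fun _ y => (y - s k) / σ k j) (fun _ => by fun_prop)
  have h2 := (iIndepFun_iff_map_fun_eq_pi_map (fun i => Measurable.aemeasurable (by fun_prop))).1 h1
  simp only [Function.comp_def] at h2
  rw [h2]
  congr 1
  funext i
  have hc : (fun x : ScoreTable K J => (x (k, j, (i : ℕ)) - s k) / σ k j) =
    (fun y => y / σ k j) ∘ (fun y => y - s k) ∘ fun x => x (k, j, (i : ℕ)) := rfl
  rw [hc, ← Measure.map_map (by fun_prop) (by fun_prop),
    ← Measure.map_map (by fun_prop) (by fun_prop), gaussianScores_map_eval,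
    gaussianReal_map_sub_const, gaussianReal_map_div_const]
  congr 1
  · simp
  · ext
    simp [max_eq_left (sq_nonneg (σ k j)), hσ.ne']

theorem sampleVariance_eq_centredSumSq {k : Fin K} {j : Fin J} (hσ : 0 < σ k j) (n : ℕ)
    (x : ScoreTable K J) :
    sampleVariance (n + 1) x k j = (n : ℝ)⁻¹ * (σ k j ^ 2 *
      centredSumSq fun i : Fin (n + 1) => (x (k, j, (i : ℕ)) - s k) / σ k j) := by
  unfold sampleVariance centredSumSq sampleMean
  simp only [← Finset.sum_range (fun i => (x (k, j, i) - s k) / σ k j)]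
  rw [← Finset.sum_range (fun i => ((x (k, j, i) - s k) / σ k j - ((n + 1 : ℕ) : ℝ)⁻¹ *
    ∑ i ∈ Finset.range (n + 1), (x (k, j, i) - s k) / σ k j) ^ 2)]
  congr 1
  · simp
  · rw [Finset.mul_sum _ _ (σ k j ^ 2)]
    refine Finset.sum_congr rfl fun i _ => ?_
    rw [← mul_pow, ← Finset.sum_div, Finset.sum_sub_distrib]
    congr 1
    have h : ((n + 1 : ℕ) : ℝ) ≠ 0 := by positivity
    simp only [Finset.sum_const, Finset.card_range, nsmul_eq_mul, zero_add]
    field_simp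
    ring

theorem measure_sampleVariance_notMem_Icc_le {k : Fin K} {j : Fin J} (hσ : 0 < σ k j) {n : ℕ}
    (hn : n ≠ 0) :
    (gaussianScores s σ).real
      {x | sampleVariance (n + 1) x k j ∉ Set.Icc (σ k j ^ 2 / 2) (13 / 8 * σ k j ^ 2)} ≤
      2 * Real.exp (-(n / 16)) := by
  set Z : ScoreTable K J → Fin (n + 1) → ℝ := fun x i => (x (k, j, (i : ℕ)) - s k) / σ k j with hZ
  have hZm : Measurable Z := by fun_prop
  have hn0 : (0 : ℝ) < n := by positivity
  have hs : 0 < σ k j ^ 2 := by positivity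
  have hpre : ∀ A : Set (Fin (n + 1) → ℝ), MeasurableSet A → (gaussianScores s σ).real (Z ⁻¹' A) =
      (Measure.pi fun _ : Fin (n + 1) => gaussianReal 0 1).real A := fun A hA => by
    rw [← gaussianScores_map_standardised (s := s) hσ (n + 1), map_measureReal_apply hZm hA]
  have hm := measurable_centredSumSq (n := n)
  have h1 := measure_centredSumSq_ge_le n
  have h2 := measure_centredSumSq_le_le n
  rw [← hpre _ (measurableSet_le measurable_const hm)] at h1
  rw [← hpre _ (measurableSet_le hm measurable_const)] at h2
  refine (measureReal_mono ?_).trans ((measureReal_union_le _ _).trans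
    ((add_le_add h1 h2).trans_eq (two_mul _).symm))
  intro x hx
  simp only [Set.mem_ofPred_eq, Set.mem_Icc, not_and_or, not_le] at hx
  rw [sampleVariance_eq_centredSumSq (s := s) hσ, inv_mul_lt_iff₀ hn0, lt_inv_mul_iff₀ hn0] at hx
  rcases hx with hx | hx
  · right
    have : σ k j ^ 2 * centredSumSq (Z x) < σ k j ^ 2 * (n / 2) := by linarith
    exact (lt_of_mul_lt_mul_left this hs.le).le
  · left
    have : σ k j ^ 2 * (13 / 8 * n) < σ k j ^ 2 * centredSumSq (Z x) := by linarith
    exact (lt_of_mul_lt_mul_left this hs.le).le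

theorem hasSubgaussianMGF_score (s : Fin K → ℝ) (σ : Fin K → Fin J → ℝ) (k : Fin K) (j : Fin J)
    (n : ℕ) : HasSubgaussianMGF (fun x : ScoreTable K J => x (k, j, n) - s k)
      ((σ k j ^ 2).toNNReal) (gaussianScores s σ) := by
  have hm : (gaussianScores s σ).map (fun x : ScoreTable K J => x (k, j, n) - s k) =
      gaussianReal 0 ((σ k j ^ 2).toNNReal) := by
    have hc : (fun x : ScoreTable K J => x (k, j, n) - s k) =
      (fun y => y - s k) ∘ fun x => x (k, j, n) := rfl
    rw [hc, ← Measure.map_map (by fun_prop) (by fun_prop), gaussianScores_map_eval,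
      gaussianReal_map_sub_const, sub_self]
  refine HasSubgaussianMGF.of_map (Y := fun x : ScoreTable K J => x (k, j, n) - s k)
    (X := id) (Measurable.aemeasurable (by fun_prop)) ?_
  rw [hm]
  exact ⟨integrable_exp_mul_gaussianReal, fun t => by rw [mgf_id_gaussianReal]; simp⟩

theorem measure_sampleMean_sub_gt_le {k : Fin K} {j : Fin J} (hσ : 0 < σ k j) (a : ℕ) {N : ℕ}
    (hN : 0 < N) {L : ℝ} (hL : 0 ≤ L) :
    (gaussianScores s σ).real {x | σ k j * √(2 * L / N) < |sampleMean x a N k j - s k|} ≤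
      2 * Real.exp (-L) := by
  have hN0 : (0 : ℝ) < N := by positivity
  have hinj : Function.Injective fun i : ℕ => ((k, j, a + i) : Fin K × Fin J × ℕ) :=
    fun a b h => by simpa using h
  have hind := ((iIndepFun_scores s σ).precomp hinj).comp
    (fun _ y => y - s k) (fun _ => by fun_prop)
  simp only [Function.comp_def] at hind
  have hsub := HasSubgaussianMGF.sum_of_iIndepFun hind (s := Finset.range N)
    (c := fun _ => (σ k j ^ 2).toNNReal) fun i _ => hasSubgaussianMGF_score s σ k j (a + i)
  have he : 0 ≤ N * (σ k j * √(2 * L / N)) := by positivity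
  -- The deviation is chosen so that the sub-Gaussian exponent is exactly `-L`.
  have hexp : -(N * (σ k j * √(2 * L / N))) ^ 2 /
      (2 * ((∑ i ∈ Finset.range N, (σ k j ^ 2).toNNReal : ℝ≥0) : ℝ)) = -L := by
    rw [mul_pow, mul_pow, Real.sq_sqrt (by positivity)]
    simp [max_eq_left (sq_nonneg (σ k j))]
    field_simp
  have h1 := hsub.measure_ge_le he
  have h2 := hsub.neg.measure_ge_le he
  rw [hexp] at h1 h2
  refine (measureReal_mono ?_).trans ((measureReal_union_le _ _).trans
    ((add_le_add h1 h2).trans_eq (two_mul _).symm))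
  intro x hx
  have hsum : ∑ i ∈ Finset.range N, (x (k, j, a + i) - s k) =
      N * (sampleMean x a N k j - s k) := by
    simp only [sampleMean, Finset.sum_sub_distrib, Finset.sum_const, Finset.card_range,
      nsmul_eq_mul]
    field_simp
  simp only [Set.mem_union, Set.mem_ofPred_eq, Pi.neg_apply, hsum, ← mul_neg,
    mul_le_mul_iff_right₀ hN0] at hx ⊢
  exact le_abs.1 hx.le

/-- The variances read the calls numbered below `N₀`, the mean only later ones: disjoint sets of
independent coordinates. -/
theorem indepFun_sampleVariance_sampleMean (s : Fin K → ℝ) (σ : Fin K → Fin J → ℝ) (N₀ N : ℕ)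
    (k : Fin K) (j : Fin J) :
    IndepFun (sampleVariance N₀) (fun x : ScoreTable K J => sampleMean x N₀ N k j)
      (gaussianScores s σ) := by
  classical
  let S : Finset (Fin K × Fin J × ℕ) := Finset.univ ×ˢ Finset.univ ×ˢ Finset.range N₀
  let T : Finset (Fin K × Fin J × ℕ) := (Finset.range N).image fun i => (k, j, N₀ + i)
  have hST : Disjoint S T := by
    rw [Finset.disjoint_left]
    rintro ⟨k', j', n⟩ h1 h2
    simp only [S, T, Finset.mem_product, Finset.mem_univ, Finset.mem_range, true_and,
      Finset.mem_image, Prod.mk.injEq] at h1 h2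
    omega
  -- Extension by zero lets a function of the whole table be applied to finitely many coordinates.
  let ext (U : Finset (Fin K × Fin J × ℕ)) (r : U → ℝ) : ScoreTable K J :=
    fun i => if h : i ∈ U then r ⟨i, h⟩ else 0
  have hext : ∀ U, Measurable (ext U) := fun U => measurable_pi_lambda _ fun i => by
    by_cases h : i ∈ U
    · simpa only [ext, h, dite_true] using measurable_pi_apply _
    · simp only [ext, h, dite_false, measurable_const]
  have h := ((iIndepFun_scores s σ).indepFun_finset S T hST fun i => measurable_pi_apply i).comp
    ((measurable_sampleVariance N₀).comp (hext S))
    ((measurable_sampleMean (measurable_const (a := N)) N₀ k j).comp (hext T))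
  convert! h using 1
  · funext x
    refine sampleVariance_congr fun k j n hn => ?_
    have hmem : (k, j, n) ∈ S := by simp [S, hn]
    simp [ext, hmem]
  · funext x
    simp only [sampleMean, Function.comp_apply]
    congr 1
    refine Finset.sum_congr rfl fun i hi => ?_
    have hmem : (k, j, N₀ + i) ∈ T := Finset.mem_image_of_mem _ hi
    simp [ext, hmem]

/-- The pair `τ` takes countably many values. On each event that `τ` equals `q`, independence
factors out the tail bound for the fixed judge and count `q`, which is the same for all `q`. -/
theorem measure_sampleMean_random_sub_gt_le (hσ : ∀ k j, 0 < σ k j) (N₀ : ℕ) (k : Fin K)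
    {τ : (Fin K → Fin J → ℝ) → Fin J × ℕ} (hτ : Measurable τ) {L : ℝ} (hL : 0 ≤ L) :
    (gaussianScores s σ).real {x | 0 < (τ (sampleVariance N₀ x)).2 ∧
      σ k (τ (sampleVariance N₀ x)).1 * √(2 * L / (τ (sampleVariance N₀ x)).2) <
        |sampleMean x N₀ (τ (sampleVariance N₀ x)).2 k (τ (sampleVariance N₀ x)).1 - s k|} ≤
      2 * Real.exp (-L) := by
  set P := gaussianScores s σ with hP
  set t : ScoreTable K J → Fin J × ℕ := fun x => τ (sampleVariance N₀ x) with ht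
  have htm : Measurable t := hτ.comp (measurable_sampleVariance N₀)
  let A : Fin J × ℕ → Set ℝ := fun q => {y | 0 < q.2 ∧ σ k q.1 * √(2 * L / q.2) < |y - s k|}
  have hA : ∀ q, MeasurableSet (A q) := fun q => by
    have h : MeasurableSet {y : ℝ | σ k q.1 * √(2 * L / q.2) < |y - s k|} :=
      measurableSet_lt measurable_const (by fun_prop)
    exact (MeasurableSet.const _).inter h
  have hsub : {x | 0 < (t x).2 ∧ σ k (t x).1 * √(2 * L / (t x).2) <
      |sampleMean x N₀ (t x).2 k (t x).1 - s k|} ⊆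
      ⋃ q, t ⁻¹' {q} ∩ (fun x => sampleMean x N₀ q.2 k q.1) ⁻¹' A q := fun x hx =>
    Set.mem_iUnion.2 ⟨t x, rfl, hx⟩
  have hq : ∀ q, P (t ⁻¹' {q} ∩ (fun x => sampleMean x N₀ q.2 k q.1) ⁻¹' A q) ≤
      P (t ⁻¹' {q}) * ENNReal.ofReal (2 * Real.exp (-L)) := fun q => by
    have hi := (indepFun_sampleVariance_sampleMean s σ N₀ q.2 k q.1).comp hτ measurable_id
    rw [show P (t ⁻¹' {q} ∩ (fun x => sampleMean x N₀ q.2 k q.1) ⁻¹' A q) = _ from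
      hi.measure_inter_preimage_eq_mul _ _ (measurableSet_singleton q) (hA q)]
    refine mul_le_mul' le_rfl ?_
    -- Without calls there is nothing to bound: `A q` is empty.
    rcases Nat.eq_zero_or_pos q.2 with h0 | h0
    · simp [A, h0]
    · rw [← ENNReal.ofReal_toReal (measure_ne_top P _)]
      refine ENNReal.ofReal_le_ofReal (le_trans (measureReal_mono ?_)
        (measure_sampleMean_sub_gt_le (hσ k q.1) N₀ h0 hL))
      exact fun x hx => hx.2
  -- The events partition the space, so summing over `q` loses no factor.
  have htot : ∑' q, P (t ⁻¹' {q}) = 1 := by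
    rw [← measure_iUnion (fun a b hab => Disjoint.preimage _ (by simpa using hab))
      fun q => htm (measurableSet_singleton q), ← Set.preimage_iUnion, Set.iUnion_of_singleton,
      Set.preimage_univ, measure_univ]
  refine ENNReal.toReal_le_of_le_ofReal (by positivity) ((measure_mono hsub).trans
    ((measure_iUnion_le _).trans ((ENNReal.tsum_le_tsum hq).trans_eq ?_)))
  rw [ENNReal.tsum_mul_right, htot, one_mul]

end Scores

/-- The event that all sample variances of the first phase are correct up to constant factors and
all the sample means of the second phase are accurate. -/
def goodEvent {K J : ℕ} (s : Fin K → ℝ) (σ : Fin K → Fin J → ℝ) (N₀ : ℕ) (L : ℝ)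
    (τ : Fin K → (Fin K → Fin J → ℝ) → Fin J × ℕ) : Set (ScoreTable K J) :=
  {x | (∀ k j, sampleVariance N₀ x k j ∈ Set.Icc (σ k j ^ 2 / 2) (13 / 8 * σ k j ^ 2)) ∧
    ∀ k, 0 < (τ k (sampleVariance N₀ x)).2 →
      |sampleMean x N₀ (τ k (sampleVariance N₀ x)).2 k (τ k (sampleVariance N₀ x)).1 - s k| ≤
        σ k (τ k (sampleVariance N₀ x)).1 * √(2 * L / (τ k (sampleVariance N₀ x)).2)}

/-- Union bound with `n = N₀ - 1`: each of the `K * J` variances fails with probability at most `2 *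
exp (-n/16) ≤ δ/(2KJ)`, each of the `K` means with probability at most `2 * exp (-L) = δ/(2K)`. Each
group contributes `δ/2`. -/
theorem le_measure_goodEvent {K J : ℕ} [NeZero K] [NeZero J] {s : Fin K → ℝ}
    {σ : Fin K → Fin J → ℝ} (hσ : ∀ k j, 0 < σ k j) {δ : ℝ} (hδ : 0 < δ) (hδ1 : δ < 1) {n : ℕ}
    (hn : 16 * Real.log (4 * K * J / δ) ≤ n) {τ : Fin K → (Fin K → Fin J → ℝ) → Fin J × ℕ}
    (hτ : ∀ k, Measurable (τ k)) :
    ENNReal.ofReal (1 - δ) ≤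
      gaussianScores s σ (goodEvent s σ (n + 1) (Real.log (4 * K / δ)) τ) := by
  set P := gaussianScores s σ
  set L := Real.log (4 * K / δ) with hL
  have hK : (1 : ℝ) ≤ K := by exact_mod_cast NeZero.one_le
  have hJ : (1 : ℝ) ≤ J := by exact_mod_cast NeZero.one_le
  have hL0 : 0 ≤ L := Real.log_nonneg (by rw [le_div_iff₀ hδ]; linarith)
  have hl : 0 < Real.log (4 * K * J / δ) :=
    Real.log_pos (by rw [lt_div_iff₀ hδ]; nlinarith)
  have hn0 : n ≠ 0 := by
    rintro rfl
    norm_num at hn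
    linarith
  set G := goodEvent s σ (n + 1) L τ with hG
  let V : Fin K × Fin J → Set (ScoreTable K J) := fun q =>
    {x | sampleVariance (n + 1) x q.1 q.2 ∉ Set.Icc (σ q.1 q.2 ^ 2 / 2) (13 / 8 * σ q.1 q.2 ^ 2)}
  let W : Fin K → Set (ScoreTable K J) := fun k =>
    {x | 0 < (τ k (sampleVariance (n + 1) x)).2 ∧
      σ k (τ k (sampleVariance (n + 1) x)).1 * √(2 * L / (τ k (sampleVariance (n + 1) x)).2) <
        |sampleMean x (n + 1) (τ k (sampleVariance (n + 1) x)).2 k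
          (τ k (sampleVariance (n + 1) x)).1 - s k|}
  have hcover : (Set.univ : Set (ScoreTable K J)) ⊆ G ∪ ((⋃ q, V q) ∪ ⋃ k, W k) := by
    intro x _
    by_cases hV : x ∈ ⋃ q, V q
    · exact Or.inr (Or.inl hV)
    by_cases hW : x ∈ ⋃ k, W k
    · exact Or.inr (Or.inr hW)
    left
    simp only [Set.mem_iUnion, not_exists] at hV hW
    exact ⟨fun k j => not_not.1 (hV (k, j)), fun k hk => not_lt.1 fun h => hW k ⟨hk, h⟩⟩
  have hV : P.real (⋃ q, V q) ≤ δ / 2 := by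
    refine (measureReal_iUnion_fintype_le _).trans ((Finset.sum_le_sum fun q _ =>
      measure_sampleVariance_notMem_Icc_le (hσ q.1 q.2) hn0).trans ?_)
    have : Real.exp (-((n : ℝ) / 16)) ≤ δ / (4 * K * J) := by
      rw [← inv_div (4 * (K : ℝ) * J), ← Real.exp_log (show 0 < 4 * K * J / δ by positivity), ← Real.exp_neg]
      exact Real.exp_le_exp.2 (by linarith)
    simp only [Finset.sum_const, Finset.card_univ, Fintype.card_prod, Fintype.card_fin,
      nsmul_eq_mul, Nat.cast_mul]
    calc (K * J : ℝ) * (2 * Real.exp (-((n : ℝ) / 16))) ≤ K * J * (2 * (δ / (4 * K * J))) := by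
          gcongr
      _ = δ / 2 := by field_simp; ring
  have hW : P.real (⋃ k, W k) ≤ δ / 2 := by
    refine (measureReal_iUnion_fintype_le _).trans ((Finset.sum_le_sum fun k _ =>
      measure_sampleMean_random_sub_gt_le hσ (n + 1) k (hτ k) hL0).trans ?_)
    rw [hL, Real.exp_neg, Real.exp_log (by positivity)]
    simp only [Finset.sum_const, Finset.card_univ, Fintype.card_fin, nsmul_eq_mul]
    refine le_of_eq ?_
    field_simp
    ring
  refine ENNReal.ofReal_le_of_le_toReal ?_
  have h1 : 1 ≤ P.real G + P.real ((⋃ q, V q) ∪ ⋃ k, W k) := by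
    rw [← probReal_univ (μ := P)]
    exact (measureReal_mono hcover).trans (measureReal_union_le _ _)
  have h2 := measureReal_union_le (μ := P) (⋃ q, V q) (⋃ k, W k)
  change 1 - δ ≤ P.real G
  linarith

end BudgetedJudges

/-! ### Closed form of the allocation problem and the lower bound on its value -/

namespace BudgetedJudges

/-- The minimal cost-weighted variance `min_j c_j v_{k,j}` of query `k`. -/
noncomputable def queryValue {K J : ℕ} [NeZero J] (c : Fin J → ℝ) (v : Fin K → Fin J → ℝ)
    (k : Fin K) : ℝ :=
  c (optimalJudge c v k) * v k (optimalJudge c v k)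

/-- The closed form `(∑ k, m_k ^ (p / (p + 2))) ^ ((p + 2) / p)` of the optimal value of the
allocation objective. -/
noncomputable def closedForm {K : ℕ} (p : ℝ≥0∞) (m : Fin K → ℝ) : ℝ :=
  (∑ k, m k ^ allocationExponent p) ^ (1 / allocationExponent p)

theorem toReal_pos_of_one_le {p : ℝ≥0∞} (hp : 1 ≤ p) (hp' : p ≠ ∞) : 0 < p.toReal :=
  ENNReal.toReal_pos (by rintro rfl; simp at hp) hp'

theorem allocationExponent_pos {p : ℝ≥0∞} (hp : 1 ≤ p) : 0 < allocationExponent p := by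
  unfold allocationExponent
  split_ifs with h
  · exact one_pos
  · have := toReal_pos_of_one_le hp h
    positivity

section Objective

variable {K : ℕ} {p : ℝ≥0∞}

theorem closedForm_pos [NeZero K] {m : Fin K → ℝ} (hm : ∀ k, 0 < m k) : 0 < closedForm p m :=
  Real.rpow_pos_of_pos (Finset.sum_pos (fun k _ => Real.rpow_pos_of_pos (hm k) _)
    Finset.univ_nonempty) _

/-- `closedForm` is monotone and homogeneous of degree one, so relative errors in the variances pass
to it unchanged. -/
theorem closedForm_le_mul (hp : 1 ≤ p) {v m : Fin K → ℝ} (hv : ∀ k, 0 ≤ v k)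
    (hm : ∀ k, 0 ≤ m k) {r : ℝ} (hr : 0 ≤ r) (h : ∀ k, v k ≤ r * m k) :
    closedForm p v ≤ r * closedForm p m := by
  have ha := allocationExponent_pos hp
  unfold closedForm
  set a := allocationExponent p
  have hm' : 0 ≤ ∑ k, m k ^ a := Finset.sum_nonneg fun k _ => Real.rpow_nonneg (hm k) _
  calc (∑ k, v k ^ a) ^ (1 / a) ≤ (r ^ a * ∑ k, m k ^ a) ^ (1 / a) := by
        refine Real.rpow_le_rpow (Finset.sum_nonneg fun k _ => Real.rpow_nonneg (hv k) _) ?_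
          (by positivity)
        rw [Finset.mul_sum]
        refine Finset.sum_le_sum fun k _ => ?_
        rw [← Real.mul_rpow hr (hm k)]
        exact Real.rpow_le_rpow (hv k) (h k) ha.le
    _ = r * (∑ k, m k ^ a) ^ (1 / a) := by
        rw [Real.mul_rpow (by positivity) hm', ← Real.rpow_mul hr, mul_one_div_cancel ha.ne',
          Real.rpow_one]

/-- With `a = r/(r+2)`, Hölder's inequality with exponents `(r+2)/2` and `(r+2)/r` is applied to the
factorisation `m^a = S^(-a) * (m * S)^a`; the second factor then contributes a power of `∑ m * S ≤
1`. -/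
theorem rpow_sum_le_of_sum_mul_le_one {m S : Fin K → ℝ} (hm : ∀ k, 0 < m k) (hS : ∀ k, 0 < S k)
    (h : ∑ k, m k * S k ≤ 1) {r : ℝ} (hr : 0 < r) :
    (∑ k, m k ^ (r / (r + 2))) ^ (1 / (r / (r + 2))) ≤ (∑ k, S k ^ (-(r / 2))) ^ (2 / r) := by
  have hconj : ((r + 2) / 2).HolderConjugate ((r + 2) / r) := by
    rw [Real.holderConjugate_iff]
    constructor
    · linarith
    · field_simp
      ring
  have hmS : ∀ k, 0 < m k * S k := fun k => mul_pos (hm k) (hS k)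
  have hH := Real.inner_le_Lp_mul_Lq_of_nonneg Finset.univ hconj
    (f := fun k => S k ^ (-(r / (r + 2)))) (g := fun k => (m k * S k) ^ (r / (r + 2)))
    (fun k _ => (Real.rpow_pos_of_pos (hS k) _).le) fun k _ => (Real.rpow_pos_of_pos (hmS k) _).le
  have h1 : ∀ k, S k ^ (-(r / (r + 2))) * (m k * S k) ^ (r / (r + 2)) = m k ^ (r / (r + 2)) :=
    fun k => by
      rw [Real.mul_rpow (hm k).le (hS k).le, mul_left_comm, ← Real.rpow_add (hS k),
        neg_add_cancel, Real.rpow_zero, mul_one]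
  have h2 : ∀ k, (S k ^ (-(r / (r + 2)))) ^ ((r + 2) / 2) = S k ^ (-(r / 2)) := fun k => by
    rw [← Real.rpow_mul (hS k).le]
    congr 1
    field_simp
  have h3 : ∀ k, ((m k * S k) ^ (r / (r + 2))) ^ ((r + 2) / r) = m k * S k := fun k => by
    rw [← Real.rpow_mul (hmS k).le, show r / (r + 2) * ((r + 2) / r) = 1 by field_simp,
      Real.rpow_one]
  simp only [h1, h2, h3] at hH
  have hA : 0 ≤ ∑ k, S k ^ (-(r / 2)) :=
    Finset.sum_nonneg fun k _ => (Real.rpow_pos_of_pos (hS k) _).le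
  have hB : (∑ k, m k * S k) ^ (1 / ((r + 2) / r)) ≤ 1 :=
    Real.rpow_le_one (Finset.sum_nonneg fun k _ => (hmS k).le) h (by positivity)
  calc (∑ k, m k ^ (r / (r + 2))) ^ (1 / (r / (r + 2)))
      ≤ ((∑ k, S k ^ (-(r / 2))) ^ (1 / ((r + 2) / 2))) ^ (1 / (r / (r + 2))) := by
        refine Real.rpow_le_rpow
          (Finset.sum_nonneg fun k _ => (Real.rpow_pos_of_pos (hm k) _).le) ?_ (by positivity)
        exact hH.trans (mul_le_of_le_one_right (by positivity) hB)
    _ = (∑ k, S k ^ (-(r / 2))) ^ (2 / r) := by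
        rw [← Real.rpow_mul hA]
        congr 1
        field_simp

/-- The `ℓ_p` error of an allocation that is optimal for the variances `v`. -/
theorem norm_le_sqrt_mul_closedForm (hp : 1 ≤ p) {v e : Fin K → ℝ} (hv : ∀ k, 0 < v k) {Q : ℝ}
    (hQ : 0 ≤ Q) (he : ∀ k, e k ^ 2 ≤
      Q * (v k * (∑ k', v k' ^ allocationExponent p) / v k ^ allocationExponent p)) :
    ‖(WithLp.toLp p e : PiLp p fun _ : Fin K => ℝ)‖ ≤ √(Q * closedForm p v) := by
  have hT : 0 ≤ ∑ k, v k ^ allocationExponent p :=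
    Finset.sum_nonneg fun k _ => (Real.rpow_pos_of_pos (hv k) _).le
  unfold closedForm
  by_cases hp' : p = ∞
  · subst hp'
    simp only [allocationExponent, if_true, Real.rpow_one, div_one] at *
    rw [PiLp.norm_toLp, pi_norm_le_iff_of_nonneg (Real.sqrt_nonneg _)]
    intro k
    refine Real.abs_le_sqrt ((he k).trans_eq ?_)
    rw [mul_div_cancel_left₀ _ (hv k).ne']
  · have hr := toReal_pos_of_one_le hp hp'
    simp only [allocationExponent, if_neg hp'] at *
    rw [PiLp.norm_eq_sum hr]
    set r := p.toReal
    set T := ∑ k, v k ^ (r / (r + 2)) with hTdef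
    -- The weights make the `k`-th squared error at most `Q * T * v k ^ (2/(r+2))`; its power `r/2`
    -- is a multiple of the `k`-th summand of `T`, so the sum closes up.
    have hk : ∀ k, ‖e k‖ ^ r ≤ Q ^ (r / 2) * T ^ (r / 2) * v k ^ (r / (r + 2)) := fun k => by
      have h1 : ‖e k‖ ^ r = (e k ^ 2) ^ (r / 2) := by
        rw [Real.norm_eq_abs, ← sq_abs, ← Real.rpow_natCast, ← Real.rpow_mul (abs_nonneg _)]
        congr 1
        push_cast
        ring
      have h2 : v k * T / v k ^ (r / (r + 2)) = T * v k ^ (2 / (r + 2)) := by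
        rw [mul_comm, mul_div_assoc]
        congr 1
        rw [div_eq_mul_inv, ← Real.rpow_neg (hv k).le]
        nth_rewrite 1 [← Real.rpow_one (v k)]
        rw [← Real.rpow_add (hv k)]
        congr 1
        field_simp
        ring
      have h3 := he k
      rw [h2] at h3
      rw [h1]
      refine (Real.rpow_le_rpow (sq_nonneg _) h3 (by positivity)).trans_eq ?_
      have hvk := (hv k).le
      rw [Real.mul_rpow hQ (by positivity), Real.mul_rpow hT (by positivity), ← Real.rpow_mul hvk,
        mul_assoc]
      congr 3
      field_simp
    calc (∑ k, ‖e k‖ ^ r) ^ (1 / r) ≤ (Q ^ (r / 2) * T ^ (r / 2) * T) ^ (1 / r) := by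
          refine Real.rpow_le_rpow (Finset.sum_nonneg fun k _ => by positivity) ?_ (by positivity)
          rw [hTdef, Finset.mul_sum]
          exact Finset.sum_le_sum fun k _ => hk k
      _ = √(Q * T ^ (1 / (r / (r + 2)))) := by
          rw [Real.sqrt_eq_rpow, Real.mul_rpow hQ (by positivity), mul_assoc,
            Real.mul_rpow (by positivity) (by positivity), ← Real.rpow_mul hQ, ← Real.rpow_mul hT]
          -- `T = 0` occurs only for `K = 0`; adding exponents requires a positive base.
          rcases hT.eq_or_lt with h0 | h0
          · rw [← h0, mul_zero, Real.zero_rpow (by positivity), Real.zero_rpow (by positivity)]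
            ring
          nth_rewrite 2 [← Real.rpow_one T]
          rw [← Real.rpow_add h0, ← Real.rpow_mul hT]
          congr 2 <;> field_simp

theorem norm_toLp_mono (hp : 1 ≤ p) {e b : Fin K → ℝ} (h : ∀ k, |e k| ≤ b k) :
    ‖(WithLp.toLp p e : PiLp p fun _ : Fin K => ℝ)‖ ≤
      ‖(WithLp.toLp p b : PiLp p fun _ : Fin K => ℝ)‖ := by
  have h' : ∀ k, ‖e k‖ ≤ ‖b k‖ := fun k => (h k).trans (le_abs_self _)
  by_cases hp' : p = ∞
  · subst hp'
    rw [PiLp.norm_toLp, PiLp.norm_toLp, pi_norm_le_iff_of_nonneg (norm_nonneg _)]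
    exact fun k => (h' k).trans (norm_le_pi_norm b k)
  · have hr := toReal_pos_of_one_le hp hp'
    rw [PiLp.norm_eq_sum hr, PiLp.norm_eq_sum hr]
    refine Real.rpow_le_rpow (Finset.sum_nonneg fun k _ => by positivity) ?_ (by positivity)
    exact Finset.sum_le_sum fun k _ => Real.rpow_le_rpow (norm_nonneg _) (h' k) hr.le

variable {J : ℕ} {σ : Fin K → Fin J → ℝ} {c : Fin J → ℝ}

theorem sum_ofReal_share (hc : ∀ j, 0 < c j) {ω : Fin K × Fin J → ℝ} (hω : ∀ q, 0 ≤ ω q)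
    (k : Fin K) : ∑ j, ENNReal.ofReal (ω (k, j) / (c j * σ k j ^ 2)) =
      ENNReal.ofReal (∑ j, ω (k, j) / (c j * σ k j ^ 2)) :=
  (ENNReal.ofReal_sum_of_nonneg fun j _ =>
    div_nonneg (hω _) (mul_nonneg (hc j).le (sq_nonneg _))).symm

theorem allocationObjective_eq_ofReal (hc : ∀ j, 0 < c j) {ω : Fin K × Fin J → ℝ}
    (hω : ∀ q, 0 ≤ ω q) (hS : ∀ k, 0 < ∑ j, ω (k, j) / (c j * σ k j ^ 2)) (hp : 1 ≤ p)
    (hp' : p ≠ ∞) : allocationObjective p σ c ω = ENNReal.ofReal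
      ((∑ k, (∑ j, ω (k, j) / (c j * σ k j ^ 2)) ^ (-(p.toReal / 2))) ^ (2 / p.toReal)) := by
  have hr := toReal_pos_of_one_le hp hp'
  rw [allocationObjective, if_neg hp']
  simp only [sum_ofReal_share hc hω, ENNReal.ofReal_rpow_of_pos (hS _)]
  rw [← ENNReal.ofReal_sum_of_nonneg fun k _ => (Real.rpow_pos_of_pos (hS k) _).le,
    ENNReal.ofReal_rpow_of_nonneg (Finset.sum_nonneg fun k _ =>
      (Real.rpow_pos_of_pos (hS k) _).le) (by positivity)]

variable [NeZero J]

theorem queryValue_le (c : Fin J → ℝ) (v : Fin K → Fin J → ℝ) (k : Fin K) (j : Fin J) :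
    queryValue c v k ≤ c j * v k j :=
  argminJudge_le (fun j => c j * v k j) j

theorem queryValue_pos (hc : ∀ j, 0 < c j) {v : Fin K → Fin J → ℝ} (hv : ∀ k j, 0 < v k j)
    (k : Fin K) : 0 < queryValue c v k :=
  mul_pos (hc _) (hv _ _)

/-- Since `m k` is the smallest `c j * σ k j ^ 2`, the product `m k * S k` is at most the share of
query `k`. Hence `∑ k, m k * S k ≤ 1`, the constraint in Hölder's inequality. -/
theorem ofReal_closedForm_le_allocationObjective (hp : 1 ≤ p) (hσ : ∀ k j, 0 < σ k j)
    (hc : ∀ j, 0 < c j) {ω : Fin K × Fin J → ℝ} (hω : ω ∈ stdSimplex ℝ (Fin K × Fin J)) :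
    ENNReal.ofReal (closedForm p (queryValue c fun k j => σ k j ^ 2)) ≤
      allocationObjective p σ c ω := by
  set m := queryValue c fun k j => σ k j ^ 2 with hm
  have hm0 : ∀ k, 0 < m k := queryValue_pos hc fun k j => by have := hσ k j; positivity
  set S : Fin K → ℝ := fun k => ∑ j, ω (k, j) / (c j * σ k j ^ 2) with hS
  have hcs : ∀ k j, 0 < c j * σ k j ^ 2 := fun k j => mul_pos (hc j) (by have := hσ k j; positivity)
  have hS0 : ∀ k, 0 ≤ S k := fun k =>
    Finset.sum_nonneg fun j _ => div_nonneg (hω.1 _) (hcs k j).le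
  have hmS : ∀ k, m k * S k ≤ ∑ j, ω (k, j) := fun k => by
    rw [hS, Finset.mul_sum]
    refine Finset.sum_le_sum fun j _ => ?_
    rw [mul_div_assoc', div_le_iff₀ (hcs k j), mul_comm]
    exact mul_le_mul_of_nonneg_left (queryValue_le c _ k j) (hω.1 _)
  have hsum : ∑ k, ∑ j, ω (k, j) = 1 := by rw [← Fintype.sum_prod_type']; exact hω.2
  -- A query without budget makes the objective infinite; otherwise real powers of a positive `S`
  -- can be used.
  by_cases hz : ∃ k, S k = 0
  · obtain ⟨k, hk⟩ := hz
    have hzero : ∑ j, ENNReal.ofReal (ω (k, j) / (c j * σ k j ^ 2)) = 0 := by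
      rw [sum_ofReal_share hc hω.1]
      exact ENNReal.ofReal_eq_zero.2 hk.le
    refine le_of_le_of_eq le_top (Eq.symm ?_)
    unfold allocationObjective
    split_ifs with hp'
    · refine top_le_iff.1 (le_iSup_of_le k ?_)
      rw [hzero, ENNReal.inv_zero]
    · have hr := toReal_pos_of_one_le hp hp'
      rw [ENNReal.rpow_eq_top_iff]
      right
      refine ⟨ENNReal.sum_eq_top.2 ⟨k, Finset.mem_univ _, ?_⟩, by positivity⟩
      rw [hzero]
      exact ENNReal.zero_rpow_of_neg (by linarith)
  · push Not at hz
    have hSp : ∀ k, 0 < S k := fun k => (hS0 k).lt_of_ne (hz k).symm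
    by_cases hp' : p = ∞
    · subst hp'
      simp only [closedForm, allocationExponent, allocationObjective, if_true, Real.rpow_one,
        div_one, sum_ofReal_share hc hω.1]
      set U := ⨆ k, (ENNReal.ofReal (∑ j, ω (k, j) / (c j * σ k j ^ 2)))⁻¹ with hU
      by_cases hUt : U = ∞
      · rw [hUt]
        exact le_top
      rw [ENNReal.ofReal_le_iff_le_toReal hUt]
      -- At `p = ∞` Hölder's inequality degenerates: `1 ≤ U * S k` gives `m k ≤ U * share k`, and
      -- the shares sum to one.
      have h1 : ∀ k, m k ≤ U.toReal * ∑ j, ω (k, j) := fun k => by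
        have h2 : (ENNReal.ofReal (S k))⁻¹ ≤ U :=
          le_iSup (fun k => (ENNReal.ofReal (∑ j, ω (k, j) / (c j * σ k j ^ 2)))⁻¹) k
        rw [← ENNReal.ofReal_inv_of_pos (hSp k), ENNReal.ofReal_le_iff_le_toReal hUt,
          inv_le_iff_one_le_mul₀ (hSp k)] at h2
        calc m k ≤ m k * (U.toReal * S k) := le_mul_of_one_le_right (hm0 k).le h2
          _ = U.toReal * (m k * S k) := by ring
          _ ≤ _ := mul_le_mul_of_nonneg_left (hmS k) ENNReal.toReal_nonneg
      refine (Finset.sum_le_sum fun k _ => h1 k).trans_eq ?_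
      rw [← Finset.mul_sum, hsum, mul_one]
    · rw [allocationObjective_eq_ofReal hc hω.1 hSp hp hp', closedForm, allocationExponent,
        if_neg hp']
      refine ENNReal.ofReal_le_ofReal (rpow_sum_le_of_sum_mul_le_one hm0 hSp ?_
        (toReal_pos_of_one_le hp hp'))
      exact (Finset.sum_le_sum fun k _ => hmS k).trans hsum.le

/-- The uniform allocation has finite objective. This is needed because `toReal` would send an
infinite infimum to `0` and destroy the lower bound. -/
theorem iInf_allocationObjective_ne_top [NeZero K] (hp : 1 ≤ p) (hσ : ∀ k j, 0 < σ k j)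
    (hc : ∀ j, 0 < c j) :
    (⨅ ω ∈ stdSimplex ℝ (Fin K × Fin J), allocationObjective p σ c ω) ≠ ∞ := by
  set ω : Fin K × Fin J → ℝ := fun _ => ((Fintype.card (Fin K × Fin J) : ℕ) : ℝ)⁻¹ with hω
  have hcard : (0 : ℝ) < (Fintype.card (Fin K × Fin J) : ℕ) := by
    exact_mod_cast Fintype.card_pos
  have hω0 : ∀ q, 0 < ω q := fun q => inv_pos.2 hcard
  have hmem : ω ∈ stdSimplex ℝ (Fin K × Fin J) :=
    ⟨fun q => (hω0 q).le, by
      rw [hω, Finset.sum_const, Finset.card_univ, nsmul_eq_mul, mul_inv_cancel₀ hcard.ne']⟩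
  have hS : ∀ k, 0 < ∑ j, ω (k, j) / (c j * σ k j ^ 2) := fun k =>
    Finset.sum_pos (fun j _ => div_pos (hω0 (k, j))
      (mul_pos (hc j) (by have := hσ k j; positivity))) Finset.univ_nonempty
  refine ne_top_of_le_ne_top ?_ (iInf₂_le ω hmem)
  by_cases hp' : p = ∞
  · subst hp'
    simp only [allocationObjective, if_true, sum_ofReal_share hc hmem.1]
    refine ne_top_of_le_ne_top (ENNReal.sum_ne_top.2 fun k (_ : k ∈ Finset.univ) => ?_)
      (iSup_le fun k => Finset.single_le_sum (f := fun k =>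
        (ENNReal.ofReal (∑ j, ω (k, j) / (c j * σ k j ^ 2)))⁻¹)
        (fun _ _ => zero_le) (Finset.mem_univ k))
    exact ENNReal.inv_ne_top.2 (ENNReal.ofReal_pos.2 (hS k)).ne'
  · rw [allocationObjective_eq_ofReal hc hmem.1 hS hp hp']
    exact ENNReal.ofReal_ne_top

theorem closedForm_le_optimalObjective [NeZero K] (hp : 1 ≤ p) (hσ : ∀ k j, 0 < σ k j)
    (hc : ∀ j, 0 < c j) :
    closedForm p (queryValue c fun k j => σ k j ^ 2) ≤ optimalObjective p σ c := by
  rw [optimalObjective, ← ENNReal.ofReal_le_iff_le_toReal (iInf_allocationObjective_ne_top hp hσ hc)]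
  exact le_iInf₂ fun ω hω => ofReal_closedForm_le_allocationObjective hp hσ hc hω

theorem optimalObjective_pos [NeZero K] (hp : 1 ≤ p) (hσ : ∀ k j, 0 < σ k j)
    (hc : ∀ j, 0 < c j) : 0 < optimalObjective p σ c :=
  (closedForm_pos (queryValue_pos hc fun k j => by have := hσ k j; positivity)).trans_le
    (closedForm_le_optimalObjective hp hσ hc)

end Objective

end BudgetedJudges

/-! ### Cost and error of the algorithm on the good event -/

namespace BudgetedJudges

section Algorithm

variable {K J : ℕ}

theorem sampleVariance_nonneg {N₀ : ℕ} (hN₀ : 1 ≤ N₀) (x : ScoreTable K J) (k : Fin K)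
    (j : Fin J) : 0 ≤ sampleVariance N₀ x k j := by
  have : (1 : ℝ) ≤ N₀ := by exact_mod_cast hN₀
  exact mul_nonneg (inv_nonneg.2 (by linarith)) (Finset.sum_nonneg fun _ _ => sq_nonneg _)

theorem ivwe_eq_zero {N : Fin K → Fin J → ℕ} {k : Fin K} (h : ∀ j, N k j = 0)
    (v : Fin K → Fin J → ℝ) (a : ℕ) (x : ScoreTable K J) : ivwe N v a x k = 0 := by
  simp [ivwe, h]

theorem ivwe_eq_sampleMean {N : Fin K → Fin J → ℕ} {v : Fin K → Fin J → ℝ} {k : Fin K}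
    {j₀ : Fin J} (h : ∀ j, j ≠ j₀ → N k j = 0) (h₀ : 0 < N k j₀) (hv : 0 < v k j₀) (a : ℕ)
    (x : ScoreTable K J) : ivwe N v a x k = sampleMean x a (N k j₀) k j₀ := by
  have h₀' : (0 : ℝ) < N k j₀ := by exact_mod_cast h₀
  rw [ivwe, Finset.sum_eq_single j₀ (fun j _ hj => by simp [h j hj]) (by simp),
    Finset.sum_eq_single j₀ (fun j _ hj => by simp [h j hj]) (by simp)]
  field_simp

theorem sampleVariance_pos_of_mem_goodEvent {s : Fin K → ℝ} {σ : Fin K → Fin J → ℝ} {N₀ : ℕ}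
    {L : ℝ} {τ : Fin K → (Fin K → Fin J → ℝ) → Fin J × ℕ} {x : ScoreTable K J}
    (hσ : ∀ k j, 0 < σ k j) (hx : x ∈ goodEvent s σ N₀ L τ) (k : Fin K) (j : Fin J) :
    0 < sampleVariance N₀ x k j :=
  (by have := hσ k j; positivity : 0 < σ k j ^ 2 / 2).trans_le (hx.1 k j).1

variable [NeZero J] {p : ℝ≥0∞} {c : Fin J → ℝ}

theorem optimalCounts_eq_zero {B' : ℝ} {v : Fin K → Fin J → ℝ} {k : Fin K} {j : Fin J}
    (h : j ≠ optimalJudge c v k) : optimalCounts p c B' v k j = 0 := by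
  simp [optimalCounts, optimalShare, h]

theorem queryWeight_nonneg (hc : ∀ j, 0 < c j) {v : Fin K → Fin J → ℝ} (hv : ∀ k j, 0 ≤ v k j)
    (k : Fin K) : 0 ≤ queryWeight p c v k :=
  Real.rpow_nonneg (mul_nonneg (hc _).le (hv _ _)) _

theorem optimalCounts_optimalJudge (B' : ℝ) (v : Fin K → Fin J → ℝ) (k : Fin K) :
    optimalCounts p c B' v k (optimalJudge c v k) =
      ⌈(B' - ∑ k', c (optimalJudge c v k')) *
        (queryWeight p c v k / ∑ k', queryWeight p c v k') / c (optimalJudge c v k)⌉₊ := by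
  rw [optimalCounts, optimalShare, if_pos rfl]

/-- Rounding up adds less than one call per query, and the cost of one call per query was set aside.
-/
theorem optimalCounts_cost_le (hc : ∀ j, 0 < c j) {v : Fin K → Fin J → ℝ}
    (hv : ∀ k j, 0 ≤ v k j) {B' : ℝ} (hB : 0 ≤ B') :
    ∑ j, c j * ∑ k, (optimalCounts p c B' v k j : ℝ) ≤ B' := by
  have hw := queryWeight_nonneg (p := p) hc hv
  set T := ∑ k, queryWeight p c v k with hT
  have hT0 : 0 ≤ T := Finset.sum_nonneg fun k _ => hw k
  set B'' := B' - ∑ k, c (optimalJudge c v k) with hB''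
  have hswap : ∑ j, c j * ∑ k, (optimalCounts p c B' v k j : ℝ) =
      ∑ k, c (optimalJudge c v k) * (optimalCounts p c B' v k (optimalJudge c v k) : ℝ) := by
    simp only [Finset.mul_sum]
    rw [Finset.sum_comm]
    refine Finset.sum_congr rfl fun k _ => ?_
    exact Finset.sum_eq_single _ (fun j _ hj => by rw [optimalCounts_eq_zero hj]; simp) (by simp)
  have hcount : ∀ k, optimalCounts p c B' v k (optimalJudge c v k) =
      ⌈B'' * (queryWeight p c v k / T) / c (optimalJudge c v k)⌉₊ :=
    optimalCounts_optimalJudge B' v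
  rw [hswap]
  -- If the set-aside exceeds the budget, all counts are ceilings of nonpositive numbers, hence
  -- zero.
  rcases lt_or_ge B'' 0 with hneg | hpos
  · refine (Finset.sum_eq_zero fun k _ => ?_).trans_le hB
    rw [hcount, Nat.ceil_eq_zero.2 (div_nonpos_of_nonpos_of_nonneg
      (mul_nonpos_of_nonpos_of_nonneg hneg.le (div_nonneg (hw k) hT0)) (hc _).le)]
    simp
  · have h1 : ∀ k, c (optimalJudge c v k) *
        (optimalCounts p c B' v k (optimalJudge c v k) : ℝ) ≤
        B'' * (queryWeight p c v k / T) + c (optimalJudge c v k) := fun k => by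
      have hck := hc (optimalJudge c v k)
      have h2 := (Nat.ceil_lt_add_one (div_nonneg (mul_nonneg hpos (div_nonneg (hw k) hT0))
        hck.le)).le
      rw [hcount]
      refine (mul_le_mul_of_nonneg_left h2 hck.le).trans_eq ?_
      field_simp
    refine (Finset.sum_le_sum fun k _ => h1 k).trans ?_
    rw [Finset.sum_add_distrib, ← Finset.mul_sum, ← Finset.sum_div, ← hT]
    -- This holds even for `T = 0`, where `T / T = 0`, so the estimates need not be positive and the
    -- budget is respected on every table.
    have h3 : B'' * (T / T) ≤ B'' := mul_le_of_le_one_right hpos (div_self_le_one T)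
    linarith

/-- The judge called in the second phase on query `k` and its number of calls, as a function of
the variance estimates. -/
noncomputable def secondPhaseCall (p : ℝ≥0∞) (c : Fin J → ℝ) (B' : ℝ) (k : Fin K)
    (v : Fin K → Fin J → ℝ) : Fin J × ℕ :=
  (optimalJudge c v k, optimalCounts p c B' v k (optimalJudge c v k))

theorem measurable_secondPhaseCall (p : ℝ≥0∞) (c : Fin J → ℝ) (B' : ℝ) (k : Fin K) :
    Measurable (secondPhaseCall p c B' k) := by
  have hj : ∀ j, Measurable fun v : Fin K → Fin J → ℝ => optimalCounts p c B' v k j := fun j =>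
    (measurable_pi_apply j).comp ((measurable_pi_apply k).comp (measurable_optimalCounts p c B'))
  have h : Measurable (Function.uncurry fun j (v : Fin K → Fin J → ℝ) =>
      optimalCounts p c B' v k j) := by
    refine measurable_from_prod_countable_right fun j => ?_
    simp only [Function.uncurry]
    exact hj j
  have h' := h.comp ((measurable_optimalJudge (K := K) c k).prodMk measurable_id)
  simp only [Function.comp_def, Function.uncurry, id] at h'
  unfold secondPhaseCall
  exact (measurable_optimalJudge c k).prodMk h'

variable {s : Fin K → ℝ} {σ : Fin K → Fin J → ℝ} {B L : ℝ} {N₀ : ℕ} {x : ScoreTable K J}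

theorem abs_estimate_sub_le (hσ : ∀ k j, 0 < σ k j)
    (hx : x ∈ goodEvent s σ N₀ L (secondPhaseCall p c (B - N₀ * (K * ∑ j, c j)))) (k : Fin K)
    (hN : 0 < phaseTwoCounts p c B N₀ x k (optimalJudge c (sampleVariance N₀ x) k)) :
    |(estIVWEGaussian p c B N₀).estimate x k - s k| ≤
      σ k (optimalJudge c (sampleVariance N₀ x) k) *
        √(2 * L / phaseTwoCounts p c B N₀ x k (optimalJudge c (sampleVariance N₀ x) k)) := by
  change |ivwe (phaseTwoCounts p c B N₀ x) (sampleVariance N₀ x) N₀ x k - s k| ≤ _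
  rw [ivwe_eq_sampleMean (N := phaseTwoCounts p c B N₀ x) (fun j hj => optimalCounts_eq_zero hj) hN
    (sampleVariance_pos_of_mem_goodEvent hσ hx k _)]
  exact hx.2 k hN

/-- A bound free of `B`, for budgets so small that the second phase may buy no call and the estimate
may be the default `0`. -/
theorem abs_estimate_sub_le_const (hσ : ∀ k j, 0 < σ k j) (hL : 0 ≤ L)
    (hx : x ∈ goodEvent s σ N₀ L (secondPhaseCall p c (B - N₀ * (K * ∑ j, c j)))) (k : Fin K) :
    |(estIVWEGaussian p c B N₀).estimate x k - s k| ≤ |s k| + (∑ j, σ k j) * √(2 * L) := by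
  set j₀ := optimalJudge c (sampleVariance N₀ x) k with hj₀
  have hsum : 0 ≤ ∑ j, σ k j := Finset.sum_nonneg fun j _ => (hσ k j).le
  rcases Nat.eq_zero_or_pos (phaseTwoCounts p c B N₀ x k j₀) with h0 | h0
  · have h1 : (estIVWEGaussian p c B N₀).estimate x k = 0 := by
      refine ivwe_eq_zero (fun j => ?_) _ _ _
      by_cases hj : j = j₀
      · rw [hj, h0]
      · exact optimalCounts_eq_zero hj
    rw [h1, zero_sub, abs_neg]
    have : 0 ≤ (∑ j, σ k j) * √(2 * L) := by positivity
    linarith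
  · have h1 := abs_estimate_sub_le hσ hx k h0
    have h2 : σ k j₀ ≤ ∑ j, σ k j :=
      Finset.single_le_sum (fun j _ => (hσ k j).le) (Finset.mem_univ _)
    have h3 : (1 : ℝ) ≤ phaseTwoCounts p c B N₀ x k j₀ := by exact_mod_cast h0
    have h4 : √(2 * L / phaseTwoCounts p c B N₀ x k j₀) ≤ √(2 * L) :=
      Real.sqrt_le_sqrt (div_le_self (by positivity) h3)
    have h5 := mul_le_mul h2 h4 (Real.sqrt_nonneg _) hsum
    have := abs_nonneg (s k)
    linarith

theorem sq_le_of_abs_le_mul_sqrt {e t L n b w T a : ℝ} (he : |e| ≤ t * √(2 * L / n)) (hL : 0 ≤ L)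
    (hb : 0 < b) (hw : 0 < w) (hT : 0 < T) (ha : 0 < a) (hn : b * (w / T) / a ≤ n) :
    e ^ 2 ≤ 2 * L / b * (a * t ^ 2 * T / w) := by
  have hlow : 0 < b * (w / T) / a := by positivity
  have hn0 : 0 < n := hlow.trans_le hn
  rw [← sq_abs]
  calc |e| ^ 2 ≤ (t * √(2 * L / n)) ^ 2 := pow_le_pow_left₀ (abs_nonneg _) he 2
    _ = t ^ 2 * (2 * L / n) := by rw [mul_pow, Real.sq_sqrt (by positivity)]
    _ ≤ t ^ 2 * (2 * L / (b * (w / T) / a)) := by gcongr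
    _ = _ := by field_simp

theorem sq_estimate_sub_le (hσ : ∀ k j, 0 < σ k j) (hc : ∀ j, 0 < c j) (hL : 0 ≤ L)
    (hx : x ∈ goodEvent s σ N₀ L (secondPhaseCall p c (B - N₀ * (K * ∑ j, c j)))) {b : ℝ}
    (hb : 0 < b) (hbB : b ≤ B - (N₀ + 1) * (K * ∑ j, c j)) (k : Fin K) :
    ((estIVWEGaussian p c B N₀).estimate x k - s k) ^ 2 ≤
      2 * L / b * (c (optimalJudge c (sampleVariance N₀ x) k) *
        σ k (optimalJudge c (sampleVariance N₀ x) k) ^ 2 *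
        (∑ k', queryWeight p c (sampleVariance N₀ x) k') /
          queryWeight p c (sampleVariance N₀ x) k) := by
  have hv := sampleVariance_pos_of_mem_goodEvent hσ hx
  set v := sampleVariance N₀ x with hvdef
  set j₀ := optimalJudge c v k with hj₀
  have hw : ∀ k, 0 < queryWeight p c v k := fun k =>
    Real.rpow_pos_of_pos (queryValue_pos hc hv k) _
  set T := ∑ k', queryWeight p c v k' with hT
  have hT0 : 0 < T := Finset.sum_pos (fun k _ => hw k) ⟨k, Finset.mem_univ _⟩
  -- The set-aside depends on the random choice of judges; this bound makes the usable budget `b`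
  -- deterministic.
  have hcost : ∑ k', c (optimalJudge c v k') ≤ K * ∑ j, c j := by
    refine (Finset.sum_le_sum fun k' _ => Finset.single_le_sum (f := c)
      (fun j _ => (hc j).le) (Finset.mem_univ _)).trans_eq ?_
    simp
  have hbB' : b ≤ B - N₀ * (K * ∑ j, c j) - ∑ k', c (optimalJudge c v k') := by linarith
  have hcj := hc j₀
  have hN : b * (queryWeight p c v k / T) / c j₀ ≤ phaseTwoCounts p c B N₀ x k j₀ := by
    rw [phaseTwoCounts, ← hvdef, hj₀, optimalCounts_optimalJudge]
    refine le_trans ?_ (Nat.le_ceil _)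
    have hr : 0 ≤ queryWeight p c v k / T := div_nonneg (hw k).le hT0.le
    exact div_le_div_of_nonneg_right (mul_le_mul_of_nonneg_right hbB' hr) hcj.le
  have hN0 : (0 : ℝ) < phaseTwoCounts p c B N₀ x k j₀ :=
    (div_pos (mul_pos hb (div_pos (hw k) hT0)) hcj).trans_le hN
  exact sq_le_of_abs_le_mul_sqrt (abs_estimate_sub_le hσ hx k (by exact_mod_cast hN0)) hL hb
    (hw k) hT0 hcj hN

/-- The two ends of the variance interval enter once each: the lower end turns `2 * L / b` into `Q =
4 * L / b`, the upper end gives the factor `13/8` below. -/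
theorem norm_estimate_sub_le [NeZero K] (hp : 1 ≤ p) (hσ : ∀ k j, 0 < σ k j) (hc : ∀ j, 0 < c j)
    (hL : 0 ≤ L)
    (hx : x ∈ goodEvent s σ N₀ L (secondPhaseCall p c (B - N₀ * (K * ∑ j, c j)))) {b : ℝ}
    (hb : 0 < b) (hbB : b ≤ B - (N₀ + 1) * (K * ∑ j, c j)) :
    ‖(WithLp.toLp p ((estIVWEGaussian p c B N₀).estimate x - s) : PiLp p fun _ : Fin K => ℝ)‖ ≤
      √(13 * optimalObjective p σ c * L / (2 * b)) := by
  have hv := sampleVariance_pos_of_mem_goodEvent hσ hx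
  set v := sampleVariance N₀ x with hvdef
  have hm := queryValue_pos hc hv
  have h1 := norm_le_sqrt_mul_closedForm hp hm (e := (estIVWEGaussian p c B N₀).estimate x - s)
    (Q := 4 * L / b) (by positivity) fun k => by
      refine (sq_estimate_sub_le hσ hc hL hx hb hbB k).trans ?_
      have hk : c (optimalJudge c v k) * σ k (optimalJudge c v k) ^ 2 ≤ 2 * queryValue c v k := by
        have := mul_le_mul_of_nonneg_left (hx.1 k (optimalJudge c v k)).1
          (hc (optimalJudge c v k)).le
        rw [queryValue]
        linarith
      have hT : 0 ≤ ∑ k', queryWeight p c v k' :=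
        Finset.sum_nonneg fun k _ => queryWeight_nonneg hc (fun k j => (hv k j).le) k
      have hw : 0 ≤ queryWeight p c v k := queryWeight_nonneg hc (fun k j => (hv k j).le) k
      refine (mul_le_mul_of_nonneg_left (div_le_div_of_nonneg_right
        (mul_le_mul_of_nonneg_right hk hT) hw) (by positivity)).trans_eq ?_
      change _ = 4 * L / b * (queryValue c v k *
        (∑ k', queryWeight p c v k') / queryWeight p c v k)
      ring
  refine h1.trans (Real.sqrt_le_sqrt ?_)
  have h2 : closedForm p (queryValue c v) ≤
      13 / 8 * closedForm p (queryValue c fun k j => σ k j ^ 2) := by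
    refine closedForm_le_mul hp (fun k => (hm k).le) (fun k => (queryValue_pos hc (fun k j => by
      have := hσ k j; positivity) k).le) (by norm_num) fun k => ?_
    -- The judge chosen from the estimates may be wrong, but its estimated value does not exceed
    -- that of the truly optimal judge `j₁`.
    set j₁ := optimalJudge c (fun k j => σ k j ^ 2) k with hj₁
    calc queryValue c v k ≤ c j₁ * v k j₁ := queryValue_le c v k j₁
      _ ≤ c j₁ * (13 / 8 * σ k j₁ ^ 2) := mul_le_mul_of_nonneg_left (hx.1 k j₁).2 (hc _).le
      _ = 13 / 8 * queryValue c (fun k j => σ k j ^ 2) k := by rw [queryValue]; ring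
  have h3 := closedForm_le_optimalObjective hp hσ hc
  calc 4 * L / b * closedForm p (queryValue c v)
      ≤ 4 * L / b * (13 / 8 * optimalObjective p σ c) := by gcongr; linarith
    _ = 13 * optimalObjective p σ c * L / (2 * b) := by ring

/-- With one query and one judge no constants are lost to the estimation of the variance. -/
theorem norm_estimate_sub_le_of_subsingleton [NeZero K] [Subsingleton (Fin K)]
    [Subsingleton (Fin J)] (hp : 1 ≤ p) (hσ : ∀ k j, 0 < σ k j) (hc : ∀ j, 0 < c j) (hL : 0 ≤ L)
    (hx : x ∈ goodEvent s σ N₀ L (secondPhaseCall p c (B - N₀ * (K * ∑ j, c j)))) {b : ℝ}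
    (hb : 0 < b) (hbB : b ≤ B - (N₀ + 1) * (K * ∑ j, c j)) :
    ‖(WithLp.toLp p ((estIVWEGaussian p c B N₀).estimate x - s) : PiLp p fun _ : Fin K => ℝ)‖ ≤
      √(2 * optimalObjective p σ c * L / b) := by
  have hv := sampleVariance_pos_of_mem_goodEvent hσ hx
  have hm := queryValue_pos hc fun k j => (by have := hσ k j; positivity : 0 < σ k j ^ 2)
  have hsum : ∀ (f : Fin K → ℝ) k, ∑ k', f k' = f k := fun f k =>
    Fintype.sum_subsingleton f k
  have h1 := norm_le_sqrt_mul_closedForm hp hm (e := (estIVWEGaussian p c B N₀).estimate x - s)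
    (Q := 2 * L / b) (by positivity) fun k => by
      refine (sq_estimate_sub_le hσ hc hL hx hb hbB k).trans_eq ?_
      have hw : queryWeight p c (sampleVariance N₀ x) k ≠ 0 :=
        (Real.rpow_pos_of_pos (queryValue_pos hc hv k) _).ne'
      have hw' := (Real.rpow_pos_of_pos (hm k) (allocationExponent p)).ne'
      rw [hsum _ k, hsum _ k, mul_div_cancel_right₀ _ hw, mul_div_cancel_right₀ _ hw', queryValue,
        Subsingleton.elim (optimalJudge c (sampleVariance N₀ x) k)
          (optimalJudge c (fun k j => σ k j ^ 2) k)]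
  refine h1.trans (Real.sqrt_le_sqrt ?_)
  calc _ ≤ 2 * L / b * optimalObjective p σ c :=
        mul_le_mul_of_nonneg_left (closedForm_le_optimalObjective hp hσ hc) (by positivity)
    _ = 2 * optimalObjective p σ c * L / b := by ring

theorem isBudgetEfficient_estIVWEGaussian [NeZero K] (hσ : ∀ k j, 0 < σ k j)
    (hc : ∀ j, 0 < c j) {δ : ℝ} (hδ : 0 < δ) (hδ1 : δ < 1)
    (hN₀ : N₀ = 1 + ⌈16 * Real.log (4 * K * J / δ)⌉₊) (hB : N₀ * (K * ∑ j, c j) ≤ B) {ε : ℝ}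
    (hε : 0 < ε)
    (h : ∀ x ∈ goodEvent s σ N₀ (Real.log (4 * K / δ))
        (secondPhaseCall p c (B - N₀ * (K * ∑ j, c j))),
      ‖(WithLp.toLp p ((estIVWEGaussian p c B N₀).estimate x - s) :
        PiLp p fun _ : Fin K => ℝ)‖ ≤ ε) :
    IsBudgetEfficient (estIVWEGaussian (K := K) p c B N₀) B δ p s σ c ε where
  rate_pos := hε
  accurate := by
    refine le_trans ?_ (measure_mono h)
    rw [add_comm] at hN₀
    have := le_measure_goodEvent (s := s) hσ hδ hδ1 (Nat.le_ceil _)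
      (measurable_secondPhaseCall (K := K) p c (B - N₀ * (K * ∑ j, c j)))
    rwa [← hN₀] at this
  within_budget := by
    refine Filter.Eventually.of_forall fun x => ?_
    have h1 := optimalCounts_cost_le (p := p) hc
      (sampleVariance_nonneg (by omega : 1 ≤ N₀) x) (sub_nonneg.2 hB)
    have h2 : ∑ j, c j * ∑ k, ((estIVWEGaussian (K := K) p c B N₀).counts x k j : ℝ) =
        N₀ * (K * ∑ j, c j) + ∑ j, c j * ∑ k, (optimalCounts p c (B - N₀ * (K * ∑ j, c j))
          (sampleVariance N₀ x) k j : ℝ) := by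
      simp only [estIVWEGaussian, phaseTwoCounts, Nat.cast_add, Finset.sum_add_distrib, mul_add,
        Finset.sum_const, Finset.card_univ, Fintype.card_fin, nsmul_eq_mul, ← Finset.sum_mul]
      ring
    linarith

end Algorithm

end BudgetedJudges

/-! ### Elementary estimates for the reserved budget and for `N₀` -/

theorem rpow_three_halves {x : ℝ} (hx : 0 ≤ x) : x ^ (3 / 2 : ℝ) = x * √x := by
  rcases hx.eq_or_lt with rfl | h
  · rw [Real.zero_rpow (by norm_num), zero_mul]
  · rw [Real.sqrt_eq_rpow, show (3 / 2 : ℝ) = 1 + 1 / 2 by norm_num, Real.rpow_add h, Real.rpow_one]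

/-- The loss of reserving the fraction `t` of the budget. -/
theorem sqrt_div_sub_le {X B t : ℝ} (hX : 0 ≤ X) (hB : 0 < B) (ht : 0 ≤ t) (ht1 : t ≤ 12 / 23) :
    √(X / (B * (1 - t))) ≤ √(X / B) * (1 + 3 * t) := by
  have h1 : 0 < 1 - t := by linarith
  refine Real.sqrt_le_left (by positivity) |>.2 ?_
  rw [mul_pow, Real.sq_sqrt (by positivity), ← div_div, div_le_iff₀ h1, mul_assoc]
  refine le_mul_of_one_le_right (by positivity) ?_
  -- `(1 + 3t)² (1 - t) - 1 = t (5 + 3t - 9t²)`.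
  nlinarith [mul_nonneg ht (show 0 ≤ 5 + 3 * t - 9 * t ^ 2 by nlinarith)]

theorem sqrt_le_sqrt_add_reserve {A L ℓ B D N : ℝ} (hA : 0 ≤ A) (hL : 0 ≤ L) (hℓ : 0 ≤ ℓ)
    (hLℓ : L ≤ 3 * ℓ) (hN : 23 ≤ N) (hNℓ : N + 1 ≤ 53 * ℓ) (hD : 0 < D) (hB : 2 * (N * D) ≤ B) :
    √(13 * A * L / (2 * (B - (N + 1) * D))) ≤
      √(13 * A * L / (2 * B)) +
        1000 * D * (√A * ℓ ^ (3 / 2 : ℝ) / B ^ (3 / 2 : ℝ)) := by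
  have hB0 : 0 < B := by nlinarith
  -- From `B ≥ 2ND` and `N ≥ 23`, the reserved fraction is at most `(N+1)/(2N) ≤ 24/46 = 12/23`.
  have h1 := sqrt_div_sub_le (X := 13 * A * L / 2) (B := B) (t := (N + 1) * D / B) (by positivity)
    hB0 (by positivity) (by rw [div_le_div_iff₀ hB0 (by norm_num)]; nlinarith)
  rw [show B * (1 - (N + 1) * D / B) = B - (N + 1) * D by field_simp, div_div, div_div] at h1
  refine h1.trans ?_
  rw [mul_add, mul_one]
  refine add_le_add_right ?_ _
  have h2 : √(13 * A * L / (2 * B)) ≤ 5 * (√A * √ℓ) / √B := by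
    rw [← Real.sqrt_mul hA, Real.sqrt_le_left (by positivity), div_pow, mul_pow,
      Real.sq_sqrt (by positivity), Real.sq_sqrt hB0.le, div_le_div_iff₀ (by positivity) hB0]
    have : A * L * B ≤ A * (3 * ℓ) * B := by gcongr
    have : 0 ≤ A * ℓ * B := by positivity
    linarith
  rw [rpow_three_halves hℓ, rpow_three_halves hB0.le]
  -- `795 = 5 * 3 * 53`, where `5` comes from `13/2 * 3 ≤ 25`.
  calc √(13 * A * L / (2 * B)) * (3 * ((N + 1) * D / B))
      ≤ 5 * (√A * √ℓ) / √B * (3 * (53 * ℓ * D / B)) := by gcongr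
    _ = 795 * (D * (√A * (ℓ * √ℓ) / (B * √B))) := by field_simp; ring
    _ ≤ 1000 * (D * (√A * (ℓ * √ℓ) / (B * √B))) := by gcongr; norm_num
    _ = _ := by ring

/-- For `n ≥ 2` the logarithm `ℓ = log (n/δ)` is at least `log 2`, so `log 4 ≤ 2ℓ` and the additive
constants satisfy `3 ≤ 5ℓ`; thus `16 * 3 + 5 = 53`. For `n = 1` no such bounds hold, since `ℓ` tends
to `0` as `δ → 1`. -/
theorem initialCalls_bounds {n : ℕ} {δ : ℝ} (hn : 2 ≤ n) (hδ : 0 < δ) (hδ1 : δ < 1) :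
    Real.log (4 * n / δ) ≤ 3 * Real.log (n / δ) ∧
      (1 + ⌈16 * Real.log (4 * n / δ)⌉₊ : ℕ) + (1 : ℝ) ≤ 53 * Real.log (n / δ) := by
  have hn' : (2 : ℝ) ≤ n := by exact_mod_cast hn
  have hnδ : 2 ≤ n / δ := by rw [le_div_iff₀ hδ]; nlinarith
  have h4 : Real.log (4 * n / δ) = 2 * Real.log 2 + Real.log (n / δ) := by
    rw [mul_div_assoc, Real.log_mul (by norm_num) (by positivity), show (4 : ℝ) = 2 ^ 2 by norm_num,
      Real.log_pow]
    push_cast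
    ring
  have h2 := Real.log_le_log (by norm_num) hnδ
  have h3 := Real.log_two_gt_d9
  have h5 := (Nat.ceil_lt_add_one (by linarith : 0 ≤ 16 * Real.log (4 * n / δ))).le
  push_cast
  constructor <;> linarith

theorem le_initialCalls {n : ℕ} {δ : ℝ} (hn : 1 ≤ n) (hδ : 0 < δ) (hδ1 : δ < 1) :
    (23 : ℝ) ≤ (1 + ⌈16 * Real.log (4 * n / δ)⌉₊ : ℕ) := by
  have hn' : (1 : ℝ) ≤ n := by exact_mod_cast hn
  have h4 : Real.log 4 ≤ Real.log (4 * n / δ) :=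
    Real.log_le_log (by norm_num) (by rw [le_div_iff₀ hδ]; nlinarith)
  rw [show (4 : ℝ) = 2 ^ 2 by norm_num, Real.log_pow] at h4
  have h3 := Real.log_two_gt_d9
  have h5 := Nat.le_ceil (16 * Real.log (4 * n / δ))
  push_cast at *
  norm_num at *
  linarith

/-! ### The two error rates -/

namespace BudgetedJudges

variable {K J : ℕ} [NeZero K] [NeZero J] {p : ℝ≥0∞} {s : Fin K → ℝ} {σ : Fin K → Fin J → ℝ}
  {c : Fin J → ℝ} {δ : ℝ} {N₀ : ℕ}

theorem isBudgetEfficient_of_large_budget (hp : 1 ≤ p) (hσ : ∀ k j, 0 < σ k j)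
    (hc : ∀ j, 0 < c j) (hδ : 0 < δ) (hδ1 : δ < 1)
    (hN₀ : N₀ = 1 + ⌈16 * Real.log (4 * K * J / δ)⌉₊) {B : ℝ} (hB : 2 * (N₀ * (K * ∑ j, c j)) ≤ B)
    {M : ℝ} (hM : 1000 * (K * ∑ j, c j) ≤ M) :
    IsBudgetEfficient (estIVWEGaussian (K := K) p c B N₀) B δ p s σ c
      (√(13 * optimalObjective p σ c * Real.log (4 * K / δ) / (2 * B)) +
        M * (√(optimalObjective p σ c) * Real.log (K * J / δ) ^ (3 / 2 : ℝ) /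
          B ^ (3 / 2 : ℝ))) := by
  have hK : (1 : ℝ) ≤ K := by exact_mod_cast NeZero.one_le
  have hJ : (1 : ℝ) ≤ J := by exact_mod_cast NeZero.one_le
  have hA := optimalObjective_pos hp hσ hc
  set A := optimalObjective p σ c
  set D := K * ∑ j, c j with hD
  have hD0 : 0 < D := mul_pos (by linarith) (Finset.sum_pos (fun j _ => hc j) Finset.univ_nonempty)
  set L := Real.log (4 * K / δ) with hL
  set ℓ := Real.log (K * J / δ) with hℓ
  have hL0 : 0 < L := Real.log_pos (by rw [lt_div_iff₀ hδ]; linarith)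
  have hℓ0 : 0 < ℓ := Real.log_pos (by rw [lt_div_iff₀ hδ]; nlinarith)
  have hKJ : (1 : ℕ) ≤ K * J := Nat.mul_pos (NeZero.pos K) (NeZero.pos J)
  have hN : (23 : ℝ) ≤ N₀ := by
    have := le_initialCalls hKJ hδ hδ1
    rwa [Nat.cast_mul, ← mul_assoc, ← hN₀] at this
  have hB0 : 0 < B := by nlinarith
  have hb : 0 < B - (N₀ + 1) * D := by nlinarith
  have hM0 : 0 ≤ M := by linarith
  refine isBudgetEfficient_estIVWEGaussian hσ hc hδ hδ1 hN₀ (by nlinarith)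
    (add_pos_of_pos_of_nonneg (Real.sqrt_pos.2 (by positivity)) (by positivity)) fun x hx => ?_
  have hMD : 1000 * D * (√A * ℓ ^ (3 / 2 : ℝ) / B ^ (3 / 2 : ℝ)) ≤
      M * (√A * ℓ ^ (3 / 2 : ℝ) / B ^ (3 / 2 : ℝ)) := by gcongr
  -- For `K = J = 1` the correction term can be too small to absorb the reserve. There the leading
  -- constant is `2` instead of `13/2`, and this slack covers the at most `12/23` of the budget that
  -- is reserved, so the leading term suffices alone.
  rcases hKJ.eq_or_lt with h1 | h2
  · have hKJ1 := mul_eq_one.1 h1.symm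
    have : Subsingleton (Fin K) := Fin.subsingleton_iff_le_one.2 hKJ1.1.le
    have : Subsingleton (Fin J) := Fin.subsingleton_iff_le_one.2 hKJ1.2.le
    refine (norm_estimate_sub_le_of_subsingleton hp hσ hc hL0.le hx hb le_rfl).trans
      (le_trans (Real.sqrt_le_sqrt ?_) (le_add_of_nonneg_right (by positivity)))
    rw [div_le_div_iff₀ hb (by positivity)]
    have h3 : 4 * B ≤ 13 * (B - (N₀ + 1) * D) := by nlinarith
    have := mul_le_mul_of_nonneg_left h3 (mul_pos hA hL0).le
    linarith
  · refine (norm_estimate_sub_le hp hσ hc hL0.le hx hb le_rfl).trans (le_trans ?_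
      (add_le_add_right hMD _))
    obtain ⟨h3, h4⟩ := initialCalls_bounds h2 hδ hδ1
    rw [Nat.cast_mul, ← mul_assoc] at h3 h4
    rw [← hN₀] at h4
    refine sqrt_le_sqrt_add_reserve hA.le hL0.le hℓ0.le (le_trans ?_ h3) hN h4 hD0 hB
    refine Real.log_le_log (by positivity) ?_
    exact div_le_div_of_nonneg_right (le_mul_of_one_le_right (by positivity) hJ) hδ.le

theorem exists_isBudgetEfficient (hp : 1 ≤ p) (hσ : ∀ k j, 0 < σ k j)
    (hc : ∀ j, 0 < c j) (hδ : 0 < δ) (hδ1 : δ < 1)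
    (hN₀ : N₀ = 1 + ⌈16 * Real.log (4 * K * J / δ)⌉₊) :
    ∃ M : ℝ, 0 < M ∧ ∀ B : ℝ, N₀ * (K * ∑ j, c j) ≤ B →
      IsBudgetEfficient (estIVWEGaussian (K := K) p c B N₀) B δ p s σ c
        (√(13 * optimalObjective p σ c * Real.log (4 * K / δ) / (2 * B)) +
          M * (√(optimalObjective p σ c) * Real.log (K * J / δ) ^ (3 / 2 : ℝ) /
            B ^ (3 / 2 : ℝ))) := by
  have hK : (1 : ℝ) ≤ K := by exact_mod_cast NeZero.one_le
  have hJ : (1 : ℝ) ≤ J := by exact_mod_cast NeZero.one_le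
  have hA := optimalObjective_pos hp hσ hc
  set A := optimalObjective p σ c with hAdef
  set D := K * ∑ j, c j with hD
  have hD0 : 0 < D := mul_pos (by linarith) (Finset.sum_pos (fun j _ => hc j) Finset.univ_nonempty)
  set L := Real.log (4 * K / δ) with hL
  set ℓ := Real.log (K * J / δ) with hℓ
  have hL0 : 0 < L := Real.log_pos (by rw [lt_div_iff₀ hδ]; linarith)
  have hℓ0 : 0 < ℓ := Real.log_pos (by rw [lt_div_iff₀ hδ]; nlinarith)
  have hN : (0 : ℝ) < N₀ := by
    rw [hN₀]
    positivity
  set R := ‖(WithLp.toLp p fun k => |s k| + (∑ j, σ k j) * √(2 * L) :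
    PiLp p fun _ : Fin K => ℝ)‖ with hR
  have hR0 : 0 ≤ R := by
    have : Fact (1 ≤ p) := ⟨hp⟩
    exact norm_nonneg _
  set Q := √A * ℓ ^ (3 / 2 : ℝ) with hQ
  have hQ0 : 0 < Q := by positivity
  -- The first summand serves `B ≥ 2 * N₀ * D`. The second makes the correction term at least `R`,
  -- the error bound free of `B`, for all smaller budgets.
  refine ⟨1000 * D + R * (2 * (N₀ * D)) ^ (3 / 2 : ℝ) / Q, by positivity, fun B hB => ?_⟩
  rcases le_total (2 * (N₀ * D)) B with h2 | h2
  · exact isBudgetEfficient_of_large_budget hp hσ hc hδ hδ1 hN₀ h2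
      (le_add_of_nonneg_right (by positivity))
  · have hB0 : 0 < B := (mul_pos hN hD0).trans_le hB
    refine isBudgetEfficient_estIVWEGaussian hσ hc hδ hδ1 hN₀ hB
      (add_pos_of_pos_of_nonneg (Real.sqrt_pos.2 (by positivity)) (by positivity)) fun x hx => ?_
    refine (norm_toLp_mono hp fun k => abs_estimate_sub_le_const hσ hL0.le hx k).trans ?_
    refine le_trans ?_ (le_add_of_nonneg_left (Real.sqrt_nonneg _))
    rw [← hR, mul_div_assoc', le_div_iff₀ (by positivity), add_mul, div_mul_cancel₀ _ hQ0.ne']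
    have h3 : R * B ^ (3 / 2 : ℝ) ≤ R * (2 * (N₀ * D)) ^ (3 / 2 : ℝ) := by gcongr
    have : 0 ≤ 1000 * D * Q := by positivity
    linarith

end BudgetedJudges

theorem theoremF4 :
    ∃ M₀ : ℝ, 0 < M₀ ∧
      ∀ (K J : ℕ) [NeZero K] [NeZero J] (p : ℝ≥0∞), 1 ≤ p →
      ∀ (s : Fin K → ℝ) (σ : Fin K → Fin J → ℝ) (c : Fin J → ℝ),
      (∀ k j, 0 < σ k j) → (∀ j, 0 < c j) →
      ∀ δ : ℝ, 0 < δ → δ < 1 →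
      ∀ N₀ : ℕ, N₀ = 1 + ⌈16 * Real.log (4 * K * J / δ)⌉₊ →
        (∀ B : ℝ, 2 * (N₀ * (K * ∑ j, c j)) ≤ B →
          BudgetedJudges.IsBudgetEfficient
            (BudgetedJudges.estIVWEGaussian (K := K) p c B N₀) B δ p s σ c
            (√(13 * BudgetedJudges.optimalObjective p σ c * Real.log (4 * K / δ) / (2 * B)) +
              M₀ * (K * ∑ j, c j) *
                (√(BudgetedJudges.optimalObjective p σ c) *
                  Real.log (K * J / δ) ^ (3 / 2 : ℝ) / B ^ (3 / 2 : ℝ)))) ∧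
        ∃ M : ℝ, 0 < M ∧ ∀ B : ℝ, N₀ * (K * ∑ j, c j) ≤ B →
          BudgetedJudges.IsBudgetEfficient
            (BudgetedJudges.estIVWEGaussian (K := K) p c B N₀) B δ p s σ c
            (√(13 * BudgetedJudges.optimalObjective p σ c * Real.log (4 * K / δ) / (2 * B)) +
              M * (√(BudgetedJudges.optimalObjective p σ c) *
                Real.log (K * J / δ) ^ (3 / 2 : ℝ) / B ^ (3 / 2 : ℝ))) :=
  ⟨1000, by norm_num, fun _ _ _ _ _ hp _ _ _ hσ hc _ hδ hδ1 _ hN₀ =>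
    ⟨fun _ hB => BudgetedJudges.isBudgetEfficient_of_large_budget hp hσ hc hδ hδ1 hN₀ hB le_rfl,
      BudgetedJudges.exists_isBudgetEfficient hp hσ hc hδ hδ1 hN₀⟩⟩
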